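/- Let $\Sigma^\star\in\mathbb R^{q\times q}$ be symmetric positive definite, $\Theta^\star=(\theta^\star_{jk})=(\Sigma^\star)^{-1}$, $\mathcal A=\{(j,k):\theta^\star_{jk}\ne 0\}$, $s=\#\{(j,k): j\le k,\ \theta^\star_{jk}\neq 0\}$, $p=q(q+1)/2$, $d=\max_j\#\{k:\theta^\star_{jk}\ne0\}$ and $\|\Theta^\star_{\mathcal A}\|_{\min}=\min_{(j,k)\in\mathcal A}|\theta^\star_{jk}|$. For matrices write $\|U\|_{\max}=\max_{i,j}|u_{ij}|$ and $\|U\|_{\ell_\infty}=\max_i\sum_j|u_{ij}|$. With $H^\star=\Sigma^\star\otimes\Sigma^\star$, put $$K_1=\|\Sigma^\star\|_{\ell_\infty},\quad K_2=\|(H^\star_{\mathcal A\mathcal A})^{-1}\|_{\ell_\infty},\quad K_3=\|H^\star_{\mathcal A^c\mathcal A}(H^\star_{\mathcal A\mathcal A})^{-1}\|_{\ell_\infty}.$$ Let $x_1,\dots,x_n$ ($n\ge1$) be i.i.d. Gaussian vectors in $\mathbb R^q$ with an arbitrary mean and covariance $\Sigma^\star$, let $\widehat\Sigma_n=(\hat\sigma^n_{ij})=\frac1n\sum_k(x_k-\bar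 x)(x_k-\bar x)'$ be the sample covariance matrix, and let $\ell_n(\Theta)=-\log\det\Theta+\langle\Theta,\widehat\Sigma_n\rangle$. Let $\lambda>0$ and let $P_\lambda$ be a folded concave penalty with constants $a_1,a_2>0$ and $a>a_2$: $P_\lambda$ is increasing and concave on $[0,\infty)$ with $P_\lambda(0)=0$, it is differentiable on $(0,\infty)$, the finite limit $P_\lambda'(0):=P_\lambda'(0+)$ exists and is at least $a_1\lambda$, $P_\lambda'(t)\ge a_1\lambda$ for $t\in(0,a_2\lambda]$, and $P'_\lambda(t)=0$ for $t\ge a\lambda$. Put $a_0=\min\{1,a_2\}$. The oracle estimator $\widehat\Theta^{\mathrm{oracle}}$ is the unique minimizer of $\ell_n(\Theta)$ over $\Theta\succ0$ with $\Theta_{\mathcal A^c}=0$ (when there is one). The LLA algorithm initialized by a random matrix $\widehat\Theta^{\mathrm{initial}}$ sets $\widehat\Theta^{(0)}=\widehat\Theta^{\mathrm{initial}}$ and, for $m\ge1$, takes for $\widehat\Theta^{(m)}$ a minimizer over $\Theta\succ0$ of $\ell_n(\Theta)+\sum_{j\ne k}P'_\lambda(|\hat\theta^{(m-1)}_{jk}|)\,|\theta_{jk}|$.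 Let $\delta_0^G=\Pr(\|\widehat\Theta^{\mathrm{initial}}-\Theta^\star\|_{\max}>a_0\lambda)$. Theorem. For every $M>0$ there are constants $\nu_0,c_0,C_0>0$, depending on $M$ only, such that whenever $\max_i\sigma^\star_{ii}\le M$, the following two statements hold. (1) $\Pr(|\hat\sigma^n_{ij}-\sigma^\star_{ij}|\ge\nu)\le C_0\exp(-c_0n\nu^2)$ for all $i,j$ and all $0\le\nu\le\nu_0$. (2) If $\|\Theta^\star_{\mathcal A}\|_{\min}>(a+1)\lambda$, then with probability at least $1-\delta_0^G-\delta_1^G-\delta_2^G$ the oracle estimator exists and the LLA algorithm initialized by $\widehat\Theta^{\mathrm{initial}}$ converges to it after two iterations (the minimization problems are solvable, $\widehat\Theta^{(1)}=\widehat\Theta^{\mathrm{oracle}}$, and $\widehat\Theta^{(m)}=\widehat\Theta^{\mathrm{oracle}}$ for all $m\ge2$), where $$\delta_1^G=C_0s\exp\Bigl(-\tfrac{c_0}{4}n\min\Bigl\{\tfrac{a_1^2\lambda^2}{(2K_3+1)^2},\tfrac{1}{9K_1^2K_2^2d^2},\tfrac1{9K_1^6K_2^4d^2}\Bigr\}\Bigr)+C_0(p-s)\exp\Bigl(-\tfrac{c_0a_1^2}{4}n\lambda^2\Bigr)$$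 and $$\delta_2^G=C_0s\exp\Bigl(-\tfrac{c_0n}{4K_2^2}\min\Bigl\{\tfrac1{9K_1^2d^2},\tfrac1{9K_1^6K_2^2d^2},\bigl(\|\Theta^\star_{\mathcal A}\|_{\min}-a\lambda\bigr)^2\Bigr\}\Bigr).$$ -/

import Mathlib

open MeasureTheory ProbabilityTheory Filter Topology Set

namespace SparsePrecision

noncomputable section

/-- `P` is a folded concave penalty `P_λ` on `[0, ∞)` with constants `a, a₁, a₂`, and `dP` is its
derivative `P'_λ` on `(0, ∞)`, extended to `0` by `P'_λ(0) = P'_λ(0+)`. -/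
structure IsFoldedConcavePenalty (P dP : ℝ → ℝ) (lam a a₁ a₂ : ℝ) : Prop where
  a₁_pos : 0 < a₁
  a₂_pos : 0 < a₂
  a₂_lt_a : a₂ < a
  map_zero : P 0 = 0
  monotoneOn : MonotoneOn P (Ici 0)
  concaveOn : ConcaveOn ℝ (Ici 0) P
  hasDerivAt : ∀ t, 0 < t → HasDerivAt P (dP t) t
  tendsto_zero : Tendsto dP (𝓝[>] 0) (𝓝 (dP 0))
  le_deriv_zero : a₁ * lam ≤ dP 0
  le_deriv : ∀ t, 0 < t → t ≤ a₂ * lam → a₁ * lam ≤ dP t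
  deriv_eq_zero : ∀ t, a * lam ≤ t → dP t = 0

/-- `x₁, …, xₙ` are i.i.d. Gaussian vectors with mean `μ` and covariance matrix `S`. -/
structure IsGaussianSample {Ω : Type*} [MeasurableSpace Ω] {n q : ℕ} (Pr : Measure Ω)
    (μ : EuclideanSpace ℝ (Fin q)) (S : Matrix (Fin q) (Fin q) ℝ)
    (x : Fin n → Ω → EuclideanSpace ℝ (Fin q)) : Prop where
  indep : iIndepFun x Pr
  law : ∀ k, HasLaw (x k) (multivariateGaussian μ S) Pr

/-- The sample mean. -/
def sampleMean {n q : ℕ} (x : Fin n → EuclideanSpace ℝ (Fin q)) (i : Fin q) : ℝ :=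
  (∑ k, x k i) / n

/-- The (Gaussian maximum likelihood) sample covariance matrix, centred and normalised by `n`. -/
def sampleCov {n q : ℕ} (x : Fin n → EuclideanSpace ℝ (Fin q)) : Matrix (Fin q) (Fin q) ℝ :=
  fun i j => (∑ k, (x k i - sampleMean x i) * (x k j - sampleMean x j)) / n

/-- `‖U‖_{ℓ∞} = max_i ∑_j |u_ij|`. -/
def ellInftyNorm {m n : Type*} [Fintype n] (U : Matrix m n ℝ) : ℝ :=
  ⨆ i, ∑ j, |U i j|

/-- `‖U‖_max = max_{i,j} |u_ij|`. -/
def maxNorm {m n : Type*} (U : Matrix m n ℝ) : ℝ :=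
  ⨆ ij : m × n, |U ij.1 ij.2|

variable {q : ℕ}

/-- The support `𝒜 = {(j,k) : θ_jk ≠ 0}`, as a set of ordered pairs. -/
def supp (T : Matrix (Fin q) (Fin q) ℝ) : Finset (Fin q × Fin q) :=
  Finset.univ.filter fun jk => T jk.1 jk.2 ≠ 0

/-- `s = #{(j,k) : j ≤ k, θ_jk ≠ 0}`. -/
def suppCard (T : Matrix (Fin q) (Fin q) ℝ) : ℕ :=
  ((supp T).filter fun jk => jk.1 ≤ jk.2).card

/-- The maximal degree `d = max_j #{k : θ_jk ≠ 0}`. -/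
def maxDegree (T : Matrix (Fin q) (Fin q) ℝ) : ℕ :=
  Finset.univ.sup fun j => (Finset.univ.filter fun k => T j k ≠ 0).card

/-- `‖T_𝒜‖_min`, the smallest absolute value of an entry of `T` on its own support. -/
def minSignal (T : Matrix (Fin q) (Fin q) ℝ) : ℝ :=
  ⨅ jk : supp T, |T jk.1.1 jk.1.2|

/-- `H = S ⊗ S`. -/
def hessian (S : Matrix (Fin q) (Fin q) ℝ) : Matrix (Fin q × Fin q) (Fin q × Fin q) ℝ :=
  Matrix.kronecker S S

/-- The block `H_𝒜𝒜`, where `𝒜` is the support of `S⁻¹`. -/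
def hessianAA (S : Matrix (Fin q) (Fin q) ℝ) : Matrix (supp S⁻¹) (supp S⁻¹) ℝ :=
  (hessian S).submatrix Subtype.val Subtype.val

/-- The block `H_𝒜ᶜ𝒜`, where `𝒜` is the support of `S⁻¹`. -/
def hessianAcA (S : Matrix (Fin q) (Fin q) ℝ) :
    Matrix ((supp S⁻¹)ᶜ : Finset (Fin q × Fin q)) (supp S⁻¹) ℝ :=
  (hessian S).submatrix Subtype.val Subtype.val

/-- `K₁ = ‖S‖_{ℓ∞}`. -/
def K₁ (S : Matrix (Fin q) (Fin q) ℝ) : ℝ := ellInftyNorm S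

/-- `K₂ = ‖(H_𝒜𝒜)⁻¹‖_{ℓ∞}`. -/
def K₂ (S : Matrix (Fin q) (Fin q) ℝ) : ℝ := ellInftyNorm (hessianAA S)⁻¹

/-- `K₃ = ‖H_𝒜ᶜ𝒜 (H_𝒜𝒜)⁻¹‖_{ℓ∞}`. -/
def K₃ (S : Matrix (Fin q) (Fin q) ℝ) : ℝ := ellInftyNorm (hessianAcA S * (hessianAA S)⁻¹)

/-- The bound `δ₁` for sample size `n` and true covariance matrix `S`. -/
def delta₁ (C₀ c₀ : ℝ) (n : ℕ) (S : Matrix (Fin q) (Fin q) ℝ) (lam a₁ : ℝ) : ℝ :=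
  C₀ * suppCard S⁻¹ *
      Real.exp (-(c₀ / 4) * n *
        min (a₁ ^ 2 * lam ^ 2 / (2 * K₃ S + 1) ^ 2)
          (min (1 / (9 * K₁ S ^ 2 * K₂ S ^ 2 * (maxDegree S⁻¹ : ℝ) ^ 2))
            (1 / (9 * K₁ S ^ 6 * K₂ S ^ 4 * (maxDegree S⁻¹ : ℝ) ^ 2)))) +
    C₀ * ((q : ℝ) * (q + 1) / 2 - suppCard S⁻¹) *
      Real.exp (-(c₀ * a₁ ^ 2 / 4) * n * lam ^ 2)

/-- The bound `δ₂` for sample size `n` and true covariance matrix `S`. -/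
def delta₂ (C₀ c₀ : ℝ) (n : ℕ) (S : Matrix (Fin q) (Fin q) ℝ) (lam a : ℝ) : ℝ :=
  C₀ * suppCard S⁻¹ *
    Real.exp (-(c₀ * n / (4 * K₂ S ^ 2)) *
      min (1 / (9 * K₁ S ^ 2 * (maxDegree S⁻¹ : ℝ) ^ 2))
        (min (1 / (9 * K₁ S ^ 6 * K₂ S ^ 2 * (maxDegree S⁻¹ : ℝ) ^ 2))
          ((minSignal S⁻¹ - a * lam) ^ 2)))

/-- The Gaussian quasi-likelihood loss `ℓ(Θ) = -log det Θ + ⟨Θ, Σ̂⟩`. -/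
def loss (Shat T : Matrix (Fin q) (Fin q) ℝ) : ℝ :=
  -Real.log T.det + ∑ j, ∑ k, T j k * Shat j k

/-- The set of minimizers of `f` over `C`. -/
def argminOn {α : Type*} (C : Set α) (f : α → ℝ) : Set α :=
  {x | x ∈ C ∧ ∀ y ∈ C, f x ≤ f y}

/-- `T` is *the* oracle estimator: the unique minimizer of the loss over the positive definite
matrices that vanish wherever the true precision matrix `Tstar` vanishes. -/
def IsOracle (Tstar Shat T : Matrix (Fin q) (Fin q) ℝ) : Prop :=
  argminOn {U : Matrix (Fin q) (Fin q) ℝ | U.PosDef ∧ ∀ j k, Tstar j k = 0 → U j k = 0}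
    (loss Shat) = {T}

/-- One LLA iteration from the iterate `T`: the set of minimizers, over positive definite `U`, of
the loss plus the off-diagonal `ℓ₁` penalty with weights `P'_λ(|T_jk|)`. -/
def llaStep (dP : ℝ → ℝ) (Shat T : Matrix (Fin q) (Fin q) ℝ) : Set (Matrix (Fin q) (Fin q) ℝ) :=
  argminOn {U : Matrix (Fin q) (Fin q) ℝ | U.PosDef} fun U =>
    loss Shat U +
      ∑ jk ∈ (Finset.univ : Finset (Fin q)).offDiag, dP |T jk.1 jk.2| * |U jk.1 jk.2|

/-- `T 0, T 1, T 2, …` is a run of the LLA algorithm initialized by `Tinit`. -/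
def IsLLARun (dP : ℝ → ℝ) (Shat Tinit : Matrix (Fin q) (Fin q) ℝ)
    (T : ℕ → Matrix (Fin q) (Fin q) ℝ) : Prop :=
  T 0 = Tinit ∧ ∀ m, T (m + 1) ∈ llaStep dP Shat (T m)

/-- The LLA algorithm initialized by `Tinit` converges to `Tlim` after two iterations: the
algorithm can be run, and any run finds `Tlim` in the first iteration, finds it again in the second
one, and stays there. -/
def LLAConvergesAfterTwo (dP : ℝ → ℝ) (Shat Tinit Tlim : Matrix (Fin q) (Fin q) ℝ) : Prop :=
  (∃ T, IsLLARun dP Shat Tinit T) ∧ ∀ T, IsLLARun dP Shat Tinit T → ∀ m, 1 ≤ m → T m = Tlim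

end

end SparsePrecision

namespace SparsePrecision

noncomputable section

/-! ### Chernoff bounds for sums of independent Gaussians and of their squares. -/

section Concentration

/-! The argument is deterministic on a good event: the sample covariance `W` is within `ε` of `S` on
the support 𝒜 and within `a₁ * lam / 2` off it, and the initial estimator is within `min 1 a₂ * lam`
of `S⁻¹`.

The oracle is characterised by `T⁻¹ = W` on 𝒜. Writing `T = S⁻¹ + D` and expanding `(S⁻¹ + D)⁻¹ = S
- S D S + R(D)`, this becomes the fixed-point equation `D_𝒜 = H_𝒜𝒜⁻¹ (R(D) - (W - S))_𝒜`. Since `R`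
is of second order, the right-hand side contracts a small ball of symmetric matrices, and Banach's
theorem yields `T` (`exists_oracle_precision`). The same expansion off 𝒜 bounds the gradient `W -
T⁻¹` there by `a₁ * lam`.

An iterate with entries at least `a * lam` on 𝒜 and at most `a₂ * lam` off it produces weights that
vanish on 𝒜 and dominate this gradient off 𝒜. The strict tangent inequality for log det then makes
`T` the only minimizer of the next LLA problem (`llaStep_eq_singleton`). The initial estimator and
`T` itself are both such iterates, so the run reaches `T` at once and stays there.

For the probability, polarization turns covariances into sums of squared Gaussians, for which
Chernoff's bound gives `measureReal_sampleCov_le`. A union bound over `j ≤ k` finishes the proof,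
with `ε` the least of four thresholds, each matching one term inside the exponents of `delta₁` and
`delta₂`. -/

theorem gaussianPDFReal_mul_exp_sq (s x : ℝ) :
    gaussianPDFReal 0 1 x * Real.exp (s * x ^ 2) =
      (√(2 * Real.pi))⁻¹ * Real.exp (-(1 / 2 - s) * x ^ 2) := by
  rw [gaussianPDFReal, mul_assoc, ← Real.exp_add]
  simp only [NNReal.coe_one, mul_one, sub_zero]
  congr 2
  ring

theorem integrable_exp_mul_sq_gaussianReal {s : ℝ} (hs : s < 1 / 2) :
    Integrable (fun x => Real.exp (s * x ^ 2)) (gaussianReal 0 1) := by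
  rw [gaussianReal_of_var_ne_zero _ one_ne_zero,
    integrable_withDensity_iff_integrable_smul' (measurable_gaussianPDF _ _)
      (ae_of_all _ fun _ => gaussianPDF_lt_top)]
  simp only [toReal_gaussianPDF, smul_eq_mul, gaussianPDFReal_mul_exp_sq]
  exact (integrable_exp_neg_mul_sq (by linarith)).const_mul _

theorem integral_exp_mul_sq_gaussianReal (s : ℝ) :
    ∫ x, Real.exp (s * x ^ 2) ∂(gaussianReal 0 1) = √(1 / (1 - 2 * s)) := by
  rw [integral_gaussianReal_eq_integral_smul one_ne_zero]
  simp only [smul_eq_mul, gaussianPDFReal_mul_exp_sq]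
  rw [integral_const_mul, integral_gaussian, ← Real.sqrt_inv, ← Real.sqrt_mul (by positivity)]
  congr 1
  have := Real.pi_pos.ne'
  rcases eq_or_ne s (1 / 2) with rfl | h
  · norm_num
  · have h1 : 1 / 2 - s ≠ 0 := fun h' => h (by linarith)
    have h2 : 1 - 2 * s ≠ 0 := fun h' => h (by linarith)
    field_simp

/-- The integral is `(1 - 2s)^(-1/2)`. Taylor's formula for `log (1 - 2s)` has remainder at most
`|2s|² / (1 - |2s|) ≤ 8s²` as long as `|2s| ≤ 1/2`, and the square root halves it. -/
theorem integral_exp_mul_sq_gaussianReal_le {s : ℝ} (hs : |s| ≤ 1 / 4) :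
    ∫ x, Real.exp (s * x ^ 2) ∂(gaussianReal 0 1) ≤ Real.exp (s + 4 * s ^ 2) := by
  obtain ⟨h1, h2⟩ := abs_le.1 hs
  have hpos : 0 < 1 - 2 * s := by linarith
  have habs : |2 * s| ≤ 1 / 2 := by rw [abs_mul, abs_two]; linarith
  have hlog := Real.abs_log_sub_add_sum_range_le (x := 2 * s) (by linarith) 1
  simp only [Finset.sum_range_one, pow_one, zero_add, Nat.cast_zero, div_one] at hlog
  have hq : |2 * s| ^ (1 + 1) / (1 - |2 * s|) ≤ 8 * s ^ 2 := by
    rw [div_le_iff₀ (by linarith)]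
    have : |2 * s| ^ (1 + 1) = 4 * s ^ 2 := by rw [one_add_one_eq_two, sq_abs]; ring
    rw [this]
    nlinarith [sq_nonneg s]
  have hl := (abs_le.1 (hlog.trans hq)).1
  rw [integral_exp_mul_sq_gaussianReal, Real.sqrt_le_left (Real.exp_pos _).le, ← Real.exp_nat_mul,
    one_div, inv_le_comm₀ hpos (Real.exp_pos _), ← Real.exp_neg, ← Real.le_log_iff_exp_le hpos]
  push_cast
  linarith

/-- The moment generating function of the square of a centred normal variable. -/
theorem integrable_and_mgf_sq_le {Ω : Type*} [MeasurableSpace Ω] {Pr : Measure Ω} {Y : Ω → ℝ}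
    {v : NNReal} (hY : HasLaw Y (gaussianReal 0 v) Pr) {t : ℝ} (ht : |t * v| ≤ 1 / 4) :
    Integrable (fun ω => Real.exp (t * Y ω ^ 2)) Pr ∧
      mgf (fun ω => Y ω ^ 2) Pr t ≤ Real.exp (t * v + 4 * (t * v) ^ 2) := by
  have hlaw : gaussianReal 0 v = (gaussianReal 0 1).map (fun x => √v * x) := by
    rw [gaussianReal_map_const_mul]
    congr 1
    · simp
    · ext; simp
  have hcm : Measurable fun x : ℝ => Real.exp (t * x ^ 2) := by fun_prop
  have hfun : (fun x : ℝ => Real.exp (t * (√v * x) ^ 2)) =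
      fun x => Real.exp (t * v * x ^ 2) := by
    ext x; rw [mul_pow, Real.sq_sqrt v.coe_nonneg, mul_assoc]
  have hint : Integrable (fun x => Real.exp (t * x ^ 2)) (gaussianReal 0 v) := by
    rw [hlaw, integrable_map_measure hcm.aestronglyMeasurable (by fun_prop)]
    change Integrable (fun x : ℝ => Real.exp (t * (√v * x) ^ 2)) _
    rw [hfun]
    exact integrable_exp_mul_sq_gaussianReal (by linarith [(abs_le.1 ht).2])
  constructor
  · rw [← hY.map_eq, integrable_map_measure hcm.aestronglyMeasurable hY.aemeasurable] at hint
    exact hint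
  · have h1 : mgf (fun ω => Y ω ^ 2) Pr t = ∫ x, Real.exp (t * x ^ 2) ∂(gaussianReal 0 v) := by
      rw [← hY.map_eq, integral_map hY.aemeasurable hcm.aestronglyMeasurable]; rfl
    rw [h1, hlaw, integral_map (by fun_prop) hcm.aestronglyMeasurable, hfun]
    exact integral_exp_mul_sq_gaussianReal_le ht

variable {Ω : Type*} [MeasurableSpace Ω] {Pr : Measure Ω} [IsProbabilityMeasure Pr] {n : ℕ}

/-- Chernoff's bound for a sum of independent variables. -/
theorem measureReal_le_sum_le {Z : Fin n → Ω → ℝ} (hind : iIndepFun Z Pr)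
    (hm : ∀ k, AEMeasurable (Z k) Pr) {t b : ℝ} (ht : 0 ≤ t)
    (hint : ∀ k, Integrable (fun ω => Real.exp (t * Z k ω)) Pr)
    (hmgf : ∀ k, mgf (Z k) Pr t ≤ Real.exp b) (a : ℝ) :
    Pr.real {ω | n * a ≤ ∑ k, Z k ω} ≤ Real.exp (n * (-t * a + b)) := by
  have hsum := hind.mgf_sum₀ (t := t) hm Finset.univ
  have hpos : 0 < mgf (∑ k, Z k) Pr t := by
    rw [hsum]
    exact Finset.prod_pos fun k _ => mgf_pos (hint k)
  have hI : Integrable (fun ω => Real.exp (t * (∑ k, Z k) ω)) Pr := by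
    by_contra h
    exact hpos.ne' (mgf_undef h)
  have hle := measure_ge_le_exp_mul_mgf (n * a) ht hI
  simp only [Finset.sum_apply] at hle
  refine hle.trans ?_
  have hb : mgf (∑ k, Z k) Pr t ≤ Real.exp (n * b) := by
    rw [hsum, Real.exp_nat_mul]
    refine (Finset.prod_le_prod (fun k _ => mgf_nonneg) fun k _ => hmgf k).trans ?_
    simp
  calc _ ≤ Real.exp (-t * (n * a)) * Real.exp (n * b) := by gcongr
    _ = _ := by rw [← Real.exp_add]; congr 1; ring

theorem measureReal_le_abs_sum_le {Z : Fin n → Ω → ℝ} (hind : iIndepFun Z Pr)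
    (hm : ∀ k, AEMeasurable (Z k) Pr) {t b : ℝ} (ht : 0 ≤ t)
    (hint : ∀ k, ∀ u, |u| = t → Integrable (fun ω => Real.exp (u * Z k ω)) Pr)
    (hmgf : ∀ k, ∀ u, |u| = t → mgf (Z k) Pr u ≤ Real.exp b) (a : ℝ) :
    Pr.real {ω | n * a ≤ |∑ k, Z k ω|} ≤ 2 * Real.exp (n * (-t * a + b)) := by
  have h1 := measureReal_le_sum_le hind hm ht (fun k => hint k t (abs_of_nonneg ht))
    (fun k => hmgf k t (abs_of_nonneg ht)) a
  have habs : |(-t)| = t := by rw [abs_neg, abs_of_nonneg ht]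
  have h2 := measureReal_le_sum_le (Z := fun k ω => -Z k ω) (Pr := Pr) (t := t) (b := b)
    (hind.comp (fun _ x => -x) fun _ => measurable_neg) (fun k => (hm k).neg) ht
    (fun k => by simpa using hint k (-t) habs)
    (fun k => (mgf_neg (X := Z k)).trans_le (hmgf k (-t) habs)) a
  have hsub : {ω | n * a ≤ |∑ k, Z k ω|} ⊆
      {ω | n * a ≤ ∑ k, Z k ω} ∪ {ω | n * a ≤ ∑ k, -Z k ω} := by
    intro ω hω
    simp only [mem_ofPred_eq, mem_union, Finset.sum_neg_distrib] at hω ⊢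
    exact le_abs.1 hω
  calc _ ≤ _ := measureReal_mono hsub
    _ ≤ _ := measureReal_union_le _ _
    _ ≤ _ := by linarith

theorem measureReal_abs_sum_sq_le {Y : Fin n → Ω → ℝ} {v : NNReal} (hind : iIndepFun Y Pr)
    (hY : ∀ k, HasLaw (Y k) (gaussianReal 0 v) Pr) {B ν : ℝ} (hB : 0 < B) (hv : v ≤ B)
    (hν : 0 ≤ ν) (hνB : ν ≤ 2 * B) :
    Pr.real {ω | n * ν ≤ |∑ k, (Y k ω ^ 2 - v)|} ≤ 2 * Real.exp (-(n * ν ^ 2) / (16 * B ^ 2)) := by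
  have hv0 : (0 : ℝ) ≤ v := v.2
  have htv : ∀ u, |u| = ν / (8 * B ^ 2) → |u * v| ≤ ν / (8 * B) := by
    intro u hu
    rw [abs_mul, hu, abs_of_nonneg hv0]
    calc ν / (8 * B ^ 2) * v ≤ ν / (8 * B ^ 2) * B := by gcongr
      _ = ν / (8 * B) := by field_simp
  have htv' : ∀ u, |u| = ν / (8 * B ^ 2) → |u * v| ≤ 1 / 4 := by
    intro u hu
    refine (htv u hu).trans ?_
    rw [div_le_div_iff₀ (by positivity) (by norm_num)]
    linarith
  have hexp : ∀ u w : ℝ,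
      Real.exp (u * (w ^ 2 - v)) = Real.exp (u * w ^ 2) * Real.exp (-(u * v)) := by
    intro u w; rw [← Real.exp_add]; congr 1; ring
  -- This `t` minimizes `-tν + 4(tB)²`, with value `-ν² / (16B²)`. The hypothesis `ν ≤ 2B` is
  -- exactly what keeps `tB` below `1/4`, where the moment bound is valid.
  refine (measureReal_le_abs_sum_le (Z := fun k ω => Y k ω ^ 2 - v) (t := ν / (8 * B ^ 2))
    (b := 4 * (ν / (8 * B)) ^ 2)
    (hind.comp (fun _ x => x ^ 2 - v) fun _ => by fun_prop)
    (fun k => ((hY k).aemeasurable.pow_const 2).sub_const _) (by positivity) ?_ ?_ ν).trans ?_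
  · intro k u hu
    simp only [hexp]
    exact (integrable_and_mgf_sq_le (hY k) (htv' u hu)).1.mul_const _
  · intro k u hu
    have h := (integrable_and_mgf_sq_le (hY k) (htv' u hu)).2
    have hsq : (u * v) ^ 2 ≤ (ν / (8 * B)) ^ 2 := by
      rw [← sq_abs]
      exact pow_le_pow_left₀ (abs_nonneg _) (htv u hu) 2
    simp only [mgf, hexp] at h ⊢
    rw [integral_mul_const]
    calc _ ≤ Real.exp (u * v + 4 * (u * v) ^ 2) * Real.exp (-(u * v)) := by gcongr
      _ = Real.exp (4 * (u * v) ^ 2) := by rw [← Real.exp_add]; congr 1; ring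
      _ ≤ _ := by gcongr
  · refine le_of_eq ?_
    congr 2
    field_simp
    ring

theorem measureReal_abs_sum_le {Y : Fin n → Ω → ℝ} {v : NNReal} (hind : iIndepFun Y Pr)
    (hY : ∀ k, HasLaw (Y k) (gaussianReal 0 v) Pr) {B a : ℝ} (hB : 0 < B) (hv : v ≤ B)
    (ha : 0 ≤ a) :
    Pr.real {ω | n * a ≤ |∑ k, Y k ω|} ≤ 2 * Real.exp (-(n * a ^ 2) / (2 * B)) := by
  refine (measureReal_le_abs_sum_le (t := a / B) (b := a ^ 2 / (2 * B)) hind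
    (fun k => (hY k).aemeasurable) (by positivity) ?_ ?_ a).trans ?_
  · intro k u _
    have h : (0 : ℝ) < mgf (Y k) Pr u := by
      rw [mgf_gaussianReal (hY k).map_eq]; exact Real.exp_pos _
    by_contra h'
    exact h.ne' (mgf_undef h')
  · intro k u hu
    rw [mgf_gaussianReal (hY k).map_eq, ← sq_abs u, hu]
    gcongr
    calc 0 * u + v * (a / B) ^ 2 / 2 ≤ B * (a / B) ^ 2 / 2 := by rw [zero_mul, zero_add]; gcongr
      _ = a ^ 2 / (2 * B) := by field_simp
  · refine le_of_eq ?_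
    congr 2
    field_simp
    ring

end Concentration

/-! ### Concentration of the entries of the sample covariance matrix. -/

section SampleCovariance

open Matrix

variable {q : ℕ}

theorem hasLaw_linear_combination {S : Matrix (Fin q) (Fin q) ℝ} (hS : S.PosSemidef)
    (μ : EuclideanSpace ℝ (Fin q)) (i j : Fin q) (α β : ℝ) :
    HasLaw (fun x : EuclideanSpace ℝ (Fin q) => α * (x i - μ i) + β * (x j - μ j))
      (gaussianReal 0 (α ^ 2 * S i i + 2 * α * β * S i j + β ^ 2 * S j j).toNNReal)
      (multivariateGaussian μ S) := by
  set L : StrongDual ℝ (EuclideanSpace ℝ (Fin q)) :=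
    α • EuclideanSpace.proj i + β • EuclideanSpace.proj j with hL
  have hLx : ∀ x, L x = α * x i + β * x j := fun x => by simp [hL]
  have hvar : Var[L; multivariateGaussian μ S] =
      α ^ 2 * S i i + 2 * α * β * S i j + β ^ 2 * S j j := by
    have hm : ∀ k : Fin q, MemLp (fun x : EuclideanSpace ℝ (Fin q) => x k) 2
        (multivariateGaussian μ S) := fun k =>
      IsGaussian.memLp_dual _ (EuclideanSpace.proj (𝕜 := ℝ) k) 2 (by simp)
    have : (L : EuclideanSpace ℝ (Fin q) → ℝ) = fun x => α * x i + β * x j := funext hLx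
    rw [this, variance_fun_add ((hm i).const_mul α) ((hm j).const_mul β), variance_const_mul,
      variance_const_mul, covariance_const_mul_left, covariance_const_mul_right,
      variance_eval_multivariateGaussian hS, variance_eval_multivariateGaussian hS,
      covariance_eval_multivariateGaussian hS]
    ring
  have hmean : (multivariateGaussian μ S)[L] = L μ := by
    rw [L.integral_comp_id_comm IsGaussian.integrable_id]
    simp
  have hmap := IsGaussian.map_eq_gaussianReal (μ := multivariateGaussian μ S) L
  rw [hvar, hmean] at hmap
  refine ⟨by fun_prop, ?_⟩
  have hcomp : (fun x : EuclideanSpace ℝ (Fin q) => α * (x i - μ i) + β * (x j - μ j)) =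
      (fun y => y - L μ) ∘ L := by
    ext x
    simp only [Function.comp_apply, hLx]
    ring
  rw [hcomp, ← Measure.map_map (by fun_prop) (by fun_prop), hmap, gaussianReal_map_sub_const]
  simp

/-- Polarization, `4ab = (a + b)² - (a - b)²`, leaves only squares of Gaussians, with `v` and `w`
standing for the variances of sum and difference. The last term is the cost of centring at the
sample mean. The coefficients `1`, `0`, `-1` stay visible so that each sum matches
`hasLaw_linear_combination`. -/
theorem sampleCov_sub_eq {n : ℕ} (hn : 0 < n) (x : Fin n → EuclideanSpace ℝ (Fin q))
    (μ : EuclideanSpace ℝ (Fin q)) (i j : Fin q) (c v w : ℝ) (hc : v - w = 4 * c) :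
    n * (sampleCov x i j - c) =
      (∑ k, ((1 * (x k i - μ i) + 1 * (x k j - μ j)) ^ 2 - v)) / 4 -
      (∑ k, ((1 * (x k i - μ i) + (-1) * (x k j - μ j)) ^ 2 - w)) / 4 -
      (∑ k, (1 * (x k i - μ i) + 0 * (x k j - μ j))) *
        (∑ k, (0 * (x k i - μ i) + 1 * (x k j - μ j))) / n := by
  have hn' : (n : ℝ) ≠ 0 := by positivity
  have h1 : (∑ k, ((1 * (x k i - μ i) + 1 * (x k j - μ j)) ^ 2 - v)) / 4 -
      (∑ k, ((1 * (x k i - μ i) + (-1) * (x k j - μ j)) ^ 2 - w)) / 4 =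
      ∑ k, (x k i - μ i) * (x k j - μ j) - n * c := by
    rw [div_sub_div_same, ← Finset.sum_sub_distrib, Finset.sum_div]
    have : ∀ k, ((1 * (x k i - μ i) + 1 * (x k j - μ j)) ^ 2 - v -
        ((1 * (x k i - μ i) + (-1) * (x k j - μ j)) ^ 2 - w)) / 4 =
        (x k i - μ i) * (x k j - μ j) - c := by
      intro k
      have : c = (v - w) / 4 := by linarith
      rw [this]; ring
    simp only [this, Finset.sum_sub_distrib]
    simp
  rw [h1]
  have h2 : ∀ l, ∑ k, (x k l - μ l) = n * (sampleMean x l - μ l) := by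
    intro l
    rw [Finset.sum_sub_distrib, sampleMean]
    simp
    field_simp
  have h3 : n * sampleCov x i j = ∑ k, (x k i - μ i) * (x k j - μ j) -
      n * ((sampleMean x i - μ i) * (sampleMean x j - μ j)) := by
    have h4 : ∀ k, (x k i - sampleMean x i) * (x k j - sampleMean x j) =
        (x k i - μ i) * (x k j - μ j) - (x k i - μ i) * (sampleMean x j - μ j)
        - (sampleMean x i - μ i) * (x k j - μ j)
        + (sampleMean x i - μ i) * (sampleMean x j - μ j) := fun k => by ring
    rw [sampleCov, mul_div_cancel₀ _ hn']
    rw [Finset.sum_congr rfl fun k _ => h4 k, Finset.sum_add_distrib, Finset.sum_sub_distrib,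
      Finset.sum_sub_distrib, ← Finset.sum_mul, ← Finset.mul_sum, h2, h2]
    simp
    ring
  simp only [one_mul, zero_mul, add_zero, zero_add]
  rw [mul_sub, h3, h2, h2]
  field_simp
  ring

theorem quadratic_nonneg_of_posSemidef {S : Matrix (Fin q) (Fin q) ℝ} (hS : S.PosSemidef)
    (i j : Fin q) (c : ℝ) : 0 ≤ S i i + 2 * c * S i j + c ^ 2 * S j j := by
  have hsym : S j i = S i j := by simpa using hS.isHermitian.apply i j
  have := hS.dotProduct_mulVec_nonneg (Pi.single i 1 + c • Pi.single j 1)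
  simp [mulVec_add, mulVec_smul, dotProduct_add, add_dotProduct, hsym] at this
  linarith

theorem abs_apply_le_of_posSemidef {S : Matrix (Fin q) (Fin q) ℝ} (hS : S.PosSemidef) {M : ℝ}
    (hM : ∀ i, S i i ≤ M) (i j : Fin q) : |S i j| ≤ M := by
  rw [abs_le]
  have h1 := quadratic_nonneg_of_posSemidef hS i j 1
  have h2 := quadratic_nonneg_of_posSemidef hS i j (-1)
  constructor <;> linarith [hM i, hM j]

/-- Exponential concentration of the entries of the sample covariance matrix. -/
theorem measureReal_sampleCov_le {n : ℕ} {M : ℝ} (hM : 0 < M) {S : Matrix (Fin q) (Fin q) ℝ}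
    {μ : EuclideanSpace ℝ (Fin q)} {Ω : Type*} [MeasurableSpace Ω] {Pr : Measure Ω}
    [IsProbabilityMeasure Pr] {x : Fin n → Ω → EuclideanSpace ℝ (Fin q)} (hn : 0 < n)
    (hS : S.PosSemidef) (hSM : ∀ i, S i i ≤ M) (hx : IsGaussianSample Pr μ S x) (i j : Fin q)
    {ν : ℝ} (hν : 0 ≤ ν) (hνM : ν ≤ 3 * M) :
    Pr.real {ω | ν ≤ |sampleCov (fun k => x k ω) i j - S i j|} ≤
      8 * Real.exp (-(1 / (256 * M ^ 2)) * n * ν ^ 2) := by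
  have hn' : (0 : ℝ) < n := by positivity
  have habs := abs_le.1 (abs_apply_le_of_posSemidef hS hSM i j)
  have hSi := hSM i
  have hSj := hSM j
  have hSi0 := hS.diag_nonneg (i := i)
  have hSj0 := hS.diag_nonneg (i := j)
  have hind : ∀ α β : ℝ, iIndepFun
      (fun k ω => α * (x k ω i - μ i) + β * (x k ω j - μ j)) Pr := fun α β =>
    hx.indep.comp (fun _ y => α * (y i - μ i) + β * (y j - μ j)) fun _ => by fun_prop
  have hlaw : ∀ α β : ℝ, ∀ k, HasLaw (fun ω => α * (x k ω i - μ i) + β * (x k ω j - μ j))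
      (gaussianReal 0 (α ^ 2 * S i i + 2 * α * β * S i j + β ^ 2 * S j j).toNNReal) Pr :=
    fun α β k => (hasLaw_linear_combination hS μ i j α β).comp (hx.law k)
  have hp0 := quadratic_nonneg_of_posSemidef hS i j 1
  have hm0 := quadratic_nonneg_of_posSemidef hS i j (-1)
  -- The variances of `x_i ± x_j` are at most `4M`, since `|S i j| ≤ M`.
  have e1 := measureReal_abs_sum_sq_le (hind 1 1) (hlaw 1 1) (B := 4 * M) (by positivity)
    (by rw [Real.coe_toNNReal _ (by linarith)]; linarith) hν (by linarith)
  have e2 := measureReal_abs_sum_sq_le (hind 1 (-1)) (hlaw 1 (-1)) (B := 4 * M) (by positivity)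
    (by rw [Real.coe_toNNReal _ (by linarith)]; linarith) hν (by linarith)
  -- The threshold `√(ν / 2)` makes the product of the two centred means at most `ν / 2`. The two
  -- quadratic terms contribute less than `ν / 4` each.
  have e3 := measureReal_abs_sum_le (hind 1 0) (hlaw 1 0) (B := M) (a := √(ν / 2)) hM
    (by rw [Real.coe_toNNReal _ (by linarith)]; linarith) (by positivity)
  have e4 := measureReal_abs_sum_le (hind 0 1) (hlaw 0 1) (B := M) (a := √(ν / 2)) hM
    (by rw [Real.coe_toNNReal _ (by linarith)]; linarith) (by positivity)
  rw [Real.coe_toNNReal _ (by linarith)] at e1 e2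
  -- The tails of the means decay like `exp (-nν / (4M))`; in the range `ν ≤ 3M` the quadratic rate
  -- is weaker, so all four events share one exponential.
  have hE : Real.exp (-(n * √(ν / 2) ^ 2) / (2 * M)) ≤
      Real.exp (-(1 / (256 * M ^ 2)) * n * ν ^ 2) := by
    rw [Real.sq_sqrt (by positivity)]
    apply Real.exp_le_exp.2
    have : (n : ℝ) * ν * ν ≤ n * ν * (3 * M) := by gcongr
    have h2 : -(n * (ν / 2)) / (2 * M) = -(64 * M * n * ν) / (256 * M ^ 2) := by
      field_simp; ring
    have h3 : -(1 / (256 * M ^ 2)) * n * ν ^ 2 = -(n * ν * ν) / (256 * M ^ 2) := by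
      field_simp
    rw [h2, h3]
    rw [div_le_div_iff_of_pos_right (by positivity)]
    have := mul_nonneg (mul_nonneg hM.le hn'.le) hν
    linarith
  have hE' : Real.exp (-(n * ν ^ 2) / (16 * (4 * M) ^ 2)) =
      Real.exp (-(1 / (256 * M ^ 2)) * n * ν ^ 2) := by
    congr 1; field_simp; ring
  rw [hE'] at e1 e2
  have hsub : {ω | ν ≤ |sampleCov (fun k => x k ω) i j - S i j|} ⊆
      ({ω | n * ν ≤ |∑ k, ((1 * (x k ω i - μ i) + 1 * (x k ω j - μ j)) ^ 2 -
          (1 ^ 2 * S i i + 2 * 1 * 1 * S i j + 1 ^ 2 * S j j))|} ∪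
        {ω | n * ν ≤ |∑ k, ((1 * (x k ω i - μ i) + (-1) * (x k ω j - μ j)) ^ 2 -
          (1 ^ 2 * S i i + 2 * 1 * (-1) * S i j + (-1) ^ 2 * S j j))|}) ∪
      ({ω | n * √(ν / 2) ≤ |∑ k, (1 * (x k ω i - μ i) + 0 * (x k ω j - μ j))|} ∪
        {ω | n * √(ν / 2) ≤ |∑ k, (0 * (x k ω i - μ i) + 1 * (x k ω j - μ j))|}) := by
    intro ω hω
    by_contra hcon
    simp only [mem_union, mem_ofPred_eq, not_or, not_le] at hcon hω
    obtain ⟨⟨h1, h2⟩, h3, h4⟩ := hcon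
    have hid := sampleCov_sub_eq hn (fun k => x k ω) μ i j (S i j)
      (1 ^ 2 * S i i + 2 * 1 * 1 * S i j + 1 ^ 2 * S j j)
      (1 ^ 2 * S i i + 2 * 1 * (-1) * S i j + (-1) ^ 2 * S j j) (by ring)
    generalize (∑ k, ((1 * (x k ω i - μ i) + 1 * (x k ω j - μ j)) ^ 2 - _)) = A at *
    generalize (∑ k, ((1 * (x k ω i - μ i) + (-1) * (x k ω j - μ j)) ^ 2 - _)) = A' at *
    generalize (∑ k, (1 * (x k ω i - μ i) + 0 * (x k ω j - μ j))) = D at *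
    generalize (∑ k, (0 * (x k ω i - μ i) + 1 * (x k ω j - μ j))) = D' at *
    have hDD : |D * D' / n| ≤ n * ν / 2 := by
      rw [abs_div, abs_mul, abs_of_pos hn', div_le_iff₀ hn']
      calc |D| * |D'| ≤ (n * √(ν / 2)) * (n * √(ν / 2)) := by gcongr
        _ = n * n * (√(ν / 2) ^ 2) := by ring
        _ = n * ν / 2 * n := by rw [Real.sq_sqrt (by positivity)]; ring
    have hfin : n * |sampleCov (fun k => x k ω) i j - S i j| < n * ν := by
      rw [← abs_of_pos hn', ← abs_mul, abs_of_pos hn', hid, abs_lt]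
      rw [abs_lt] at h1 h2
      rw [abs_le] at hDD
      constructor <;> linarith [h1.1, h1.2, h2.1, h2.2, hDD.1, hDD.2]
    exact absurd (lt_of_mul_lt_mul_left hfin hn'.le) (not_lt.2 hω)
  refine (measureReal_mono hsub).trans ((measureReal_union_le _ _).trans
    ((add_le_add ((measureReal_union_le _ _).trans (add_le_add e1 e2))
      ((measureReal_union_le _ _).trans (add_le_add e3 e4))).trans (by linarith)))

end SampleCovariance

/-! ### Simultaneous diagonalization, the tangent inequality for log det, and positivity of
perturbations. -/

section LogDet

open Matrix
open scoped MatrixOrder Matrix.Norms.L2Operator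

variable {m : Type*} [Fintype m] [DecidableEq m]

/-- A positive definite and a symmetric matrix are simultaneously congruent to diagonal ones. -/
theorem exists_simultaneous_diagonal {P N : Matrix m m ℝ} (hP : P.PosDef) (hN : N.IsHermitian) :
    ∃ (C : Matrix m m ℝ) (e : m → ℝ), IsUnit C.det ∧ C * P * Cᵀ = 1 ∧ C * N * Cᵀ = diagonal e := by
  obtain ⟨B, hB, hPB⟩ : ∃ B : Matrix m m ℝ, IsUnit B ∧ P = Bᵀ * B := by
    obtain ⟨B, hB⟩ := CStarAlgebra.nonneg_iff_eq_star_mul_self.1 hP.posSemidef.nonneg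
    rw [star_eq_conjTranspose, conjTranspose_eq_transpose_of_trivial] at hB
    refine ⟨B, ?_, hB⟩
    have := hP.isUnit
    rw [hB, isUnit_iff_isUnit_det, det_mul] at this
    exact (isUnit_iff_isUnit_det _).2 (isUnit_of_mul_isUnit_right this)
  have hBd := (isUnit_iff_isUnit_det _).1 hB
  have hN' : ((B⁻¹)ᵀ * N * B⁻¹).IsHermitian := by
    simpa using isHermitian_conjTranspose_mul_mul B⁻¹ hN
  have hspec := hN'.conjStarAlgAut_star_eigenvectorUnitary
  set U : Matrix m m ℝ := (hN'.eigenvectorUnitary : Matrix m m ℝ) with hU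
  have hUU : Uᵀ * U = 1 := by
    have := Unitary.coe_star_mul_self hN'.eigenvectorUnitary
    simpa [star_eq_conjTranspose] using this
  have hBB : (B⁻¹)ᵀ * Bᵀ = 1 := by
    rw [← transpose_mul, mul_nonsing_inv _ hBd, transpose_one]
  refine ⟨Uᵀ * (B⁻¹)ᵀ, hN'.eigenvalues, ?_, ?_, ?_⟩
  · have h1 : IsUnit U.det := by
      have := congrArg det hUU
      rw [det_mul, det_one] at this
      exact IsUnit.of_mul_eq_one_right _ this
    rw [det_mul, det_transpose, det_transpose]
    exact h1.mul (isUnit_nonsing_inv_det _ hBd)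
  · rw [hPB]
    calc Uᵀ * (B⁻¹)ᵀ * (Bᵀ * B) * (Uᵀ * (B⁻¹)ᵀ)ᵀ
        = Uᵀ * ((B⁻¹)ᵀ * Bᵀ) * (B * B⁻¹) * U := by
          simp only [transpose_mul, transpose_transpose, Matrix.mul_assoc]
      _ = 1 := by rw [hBB, mul_nonsing_inv _ hBd, Matrix.mul_one, Matrix.mul_one, hUU]
  · have : Uᵀ * ((B⁻¹)ᵀ * N * B⁻¹) * U = diagonal hN'.eigenvalues := by
      rw [Unitary.conjStarAlgAut_apply] at hspec
      simpa [star_eq_conjTranspose, hU] using hspec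
    rw [← this]
    simp only [transpose_mul, transpose_transpose, Matrix.mul_assoc]

theorem inv_eq_of_congr_one {P C : Matrix m m ℝ} (h : C * P * Cᵀ = 1) : P⁻¹ = Cᵀ * C := by
  rw [Matrix.mul_assoc] at h
  exact inv_eq_right_inv (by rw [← Matrix.mul_assoc]; exact mul_eq_one_comm.1 h)

/-- Strict concavity of the logarithm of the determinant, as a tangent inequality. -/
theorem log_det_sub_log_det_lt {T U : Matrix m m ℝ} (hT : T.PosDef) (hU : U.PosDef) (hne : U ≠ T) :
    Real.log U.det - Real.log T.det < (T⁻¹ * U).trace - Fintype.card m := by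
  obtain ⟨C, e, hC, hCT, hCU⟩ := exists_simultaneous_diagonal hT hU.isHermitian
  have hpos : ∀ i, 0 < e i := by
    have : (diagonal e).PosDef := by
      rw [← hCU]
      have := ((isUnit_iff_isUnit_det _).2 hC).posDef_star_right_conjugate_iff (x := U)
      exact this.2 hU
    exact posDef_diagonal_iff.1 this
  -- In the coordinates where `T` becomes `1` and `U` becomes `diagonal e`, the claim is the sum of
  -- `log e i ≤ e i - 1`, which is strict once some `e i ≠ 1`.
  have htr : (T⁻¹ * U).trace = ∑ i, e i := by
    rw [inv_eq_of_congr_one hCT, Matrix.mul_assoc, trace_mul_comm, hCU, trace_diagonal]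
  have hlog : Real.log U.det - Real.log T.det = ∑ i, Real.log (e i) := by
    have h1 := congrArg det hCT
    have h2 := congrArg det hCU
    rw [det_mul, det_mul, det_transpose, det_one] at h1
    rw [det_mul, det_mul, det_transpose, det_diagonal] at h2
    rw [← Real.log_prod fun i _ => (hpos i).ne', ← Real.log_div hU.det_pos.ne' hT.det_pos.ne']
    congr 1
    rw [← h2, div_eq_iff hT.det_pos.ne']
    linear_combination -U.det * h1
  obtain ⟨i, hi⟩ : ∃ i, e i ≠ 1 := by
    by_contra! h
    apply hne
    have he : diagonal e = 1 := by rw [← diagonal_one]; congr 1; exact funext h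
    rw [he, ← hCT] at hCU
    have hC' : IsUnit C := (isUnit_iff_isUnit_det _).2 hC
    have hCt : IsUnit Cᵀ := (isUnit_iff_isUnit_det _).2 (by rwa [det_transpose])
    exact hC'.mul_left_cancel (hCt.mul_right_cancel hCU)
  rw [htr, hlog]
  have : (Fintype.card m : ℝ) = ∑ _i : m, (1 : ℝ) := by simp
  rw [this, ← Finset.sum_sub_distrib]
  exact Finset.sum_lt_sum (fun i _ => Real.log_le_sub_one_of_pos (hpos i))
    ⟨i, Finset.mem_univ _, Real.log_lt_sub_one_of_pos (hpos i) hi⟩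

/-- A symmetric perturbation of a positive definite matrix that is small relative to it is positive
definite. -/
theorem posDef_add_of_row_sum_lt_one {Q D : Matrix m m ℝ} (hQ : Q.PosDef) (hD : D.IsHermitian)
    {u : ℝ} (hu : u < 1) (h : ∀ i, ∑ j, |(D * Q⁻¹) i j| ≤ u) : (Q + D).PosDef := by
  obtain ⟨C, e, hC, hCQ, hCD⟩ := exists_simultaneous_diagonal hQ hD
  have hC' : IsUnit C := (isUnit_iff_isUnit_det _).2 hC
  have he : ∀ i, -1 < e i := by
    intro i
    -- The `e i` are eigenvalues of `D * Q⁻¹`, with the columns of `C⁻¹` as eigenvectors. Reading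
    -- the eigenvalue equation at the largest coordinate of a column bounds `|e i|` by the largest
    -- row sum.
    have hE : D * Q⁻¹ * C⁻¹ = C⁻¹ * diagonal e := by
      rw [inv_eq_of_congr_one hCQ, ← hCD]
      simp only [Matrix.mul_assoc]
      rw [mul_nonsing_inv _ hC, ← Matrix.mul_assoc C⁻¹ C, nonsing_inv_mul _ hC]
      simp
    have : Nonempty m := ⟨i⟩
    obtain ⟨j, hj⟩ := Finite.exists_max fun j => |C⁻¹ j i|
    have hjpos : 0 < |C⁻¹ j i| := by
      rw [abs_pos]
      intro h0
      have hz : ∀ k, C⁻¹ k i = 0 := fun k => by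
        have := hj k
        rw [h0, abs_zero] at this
        exact abs_nonpos_iff.1 this
      have h1 := congrFun (congrFun (mul_nonsing_inv _ hC) i) i
      rw [mul_apply, one_apply_eq] at h1
      simp [hz] at h1
    have h2 := congrFun (congrFun hE j) i
    rw [mul_apply, mul_diagonal] at h2
    have h3 : |e i| * |C⁻¹ j i| ≤ u * |C⁻¹ j i| := by
      rw [← abs_mul, mul_comm (e i), ← h2]
      calc |∑ k, (D * Q⁻¹) j k * C⁻¹ k i| ≤ ∑ k, |(D * Q⁻¹) j k * C⁻¹ k i| :=
            Finset.abs_sum_le_sum_abs _ _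
        _ ≤ ∑ k, |(D * Q⁻¹) j k| * |C⁻¹ j i| := by
            refine Finset.sum_le_sum fun k _ => ?_
            rw [abs_mul]
            exact mul_le_mul_of_nonneg_left (hj k) (abs_nonneg _)
        _ ≤ u * |C⁻¹ j i| := by
            rw [← Finset.sum_mul]
            exact mul_le_mul_of_nonneg_right (h j) (abs_nonneg _)
    have h4 := le_of_mul_le_mul_right h3 hjpos
    linarith [(abs_le.1 h4).1]
  have hdiag : C * (Q + D) * star C = diagonal fun i => 1 + e i := by
    change C * (Q + D) * Cᵀ = _
    rw [Matrix.mul_add, Matrix.add_mul, hCQ, hCD, ← diagonal_one, diagonal_add]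
  rw [← hC'.posDef_star_right_conjugate_iff, hdiag]
  exact PosDef.diagonal fun i => by linarith [he i]

end LogDet

/-! ### Products in the entrywise maximum and row-sum norms. -/

section Norms

variable {l m n : Type*} [Fintype m]

theorem row_sum_le_ellInftyNorm [Fintype n] (U : Matrix m n ℝ) (i : m) :
    ∑ j, |U i j| ≤ ellInftyNorm U :=
  le_ciSup (f := fun i => ∑ j, |U i j|) (Set.finite_range _).bddAbove i

theorem ellInftyNorm_nonneg {m : Type*} [Fintype n] (U : Matrix m n ℝ) : 0 ≤ ellInftyNorm U :=
  Real.iSup_nonneg fun _ => Finset.sum_nonneg fun _ _ => abs_nonneg _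

theorem abs_mul_apply_le_of_row_sum {X : Matrix l m ℝ} {D : Matrix m n ℝ} {a δ : ℝ} (hδ : 0 ≤ δ)
    (hX : ∀ i, ∑ j, |X i j| ≤ a) (hD : ∀ i j, |D i j| ≤ δ) (i : l) (j : n) :
    |(X * D) i j| ≤ a * δ := by
  rw [Matrix.mul_apply]
  calc |∑ k, X i k * D k j| ≤ ∑ k, |X i k| * δ := by
        refine (Finset.abs_sum_le_sum_abs _ _).trans (Finset.sum_le_sum fun k _ => ?_)
        rw [abs_mul]
        exact mul_le_mul_of_nonneg_left (hD k j) (abs_nonneg _)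
    _ ≤ a * δ := by
        rw [← Finset.sum_mul]
        exact mul_le_mul_of_nonneg_right (hX i) hδ

theorem abs_mul_apply_le_of_col_sum {D : Matrix l m ℝ} {Y : Matrix m n ℝ} {b δ : ℝ} (hδ : 0 ≤ δ)
    (hD : ∀ i j, |D i j| ≤ δ) (hY : ∀ j, ∑ i, |Y i j| ≤ b) (i : l) (j : n) :
    |(D * Y) i j| ≤ δ * b := by
  have := abs_mul_apply_le_of_row_sum (X := Y.transpose) (D := D.transpose) hδ hY
    (fun i j => hD j i) j i
  rw [← Matrix.transpose_mul, Matrix.transpose_apply] at this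
  linarith

theorem row_sum_mul_le [Fintype n] {X : Matrix l m ℝ} {Y : Matrix m n ℝ} {a b : ℝ} (hb : 0 ≤ b)
    (hX : ∀ i, ∑ j, |X i j| ≤ a) (hY : ∀ i, ∑ j, |Y i j| ≤ b) (i : l) :
    ∑ j, |(X * Y) i j| ≤ a * b := by
  calc ∑ j, |(X * Y) i j| ≤ ∑ j, ∑ k, |X i k| * |Y k j| := by
        refine Finset.sum_le_sum fun j _ => ?_
        rw [Matrix.mul_apply]
        refine (Finset.abs_sum_le_sum_abs _ _).trans_eq ?_
        simp only [abs_mul]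
    _ = ∑ k, |X i k| * ∑ j, |Y k j| := by
        rw [Finset.sum_comm]
        simp only [Finset.mul_sum]
    _ ≤ ∑ k, |X i k| * b :=
        Finset.sum_le_sum fun k _ => mul_le_mul_of_nonneg_left (hY k) (abs_nonneg _)
    _ ≤ a * b := by
        rw [← Finset.sum_mul]
        exact mul_le_mul_of_nonneg_right (hX i) hb

theorem abs_mulVec_le [Fintype l] {X : Matrix l m ℝ} {y : m → ℝ} {δ : ℝ} (hδ : 0 ≤ δ)
    (hy : ∀ j, |y j| ≤ δ) (i : l) : |X.mulVec y i| ≤ ellInftyNorm X * δ := by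
  have := abs_mul_apply_le_of_row_sum (X := X) (D := fun j (_ : Unit) => y j) hδ
    (row_sum_le_ellInftyNorm X) (fun j _ => hy j) i ()
  exact this

end Norms

/-! ### The oracle estimator as the fixed point of a contraction. -/

section FixedPoint

open Matrix

variable {q : ℕ}

theorem mem_supp {T : Matrix (Fin q) (Fin q) ℝ} {p : Fin q × Fin q} :
    p ∈ supp T ↔ T p.1 p.2 ≠ 0 := by
  simp [supp]

theorem card_le_maxDegree (T : Matrix (Fin q) (Fin q) ℝ) (j : Fin q) :
    (Finset.univ.filter fun k => T j k ≠ 0).card ≤ maxDegree T :=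
  Finset.le_sup (f := fun j => (Finset.univ.filter fun k => T j k ≠ 0).card) (Finset.mem_univ j)

/-- The matrix with entries `x` on the support of `T` and zeros elsewhere. -/
def supportFill (T : Matrix (Fin q) (Fin q) ℝ) (x : supp T → ℝ) : Matrix (Fin q) (Fin q) ℝ :=
  fun j k => if h : (j, k) ∈ supp T then x ⟨(j, k), h⟩ else 0

section SupportFill

variable {T : Matrix (Fin q) (Fin q) ℝ}

theorem supportFill_apply_mem (x : supp T → ℝ) (p : supp T) :
    supportFill T x p.1.1 p.1.2 = x p := by
  rw [supportFill, dif_pos (show (p.1.1, p.1.2) ∈ supp T from p.2)]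

theorem supportFill_apply_of_eq_zero (x : supp T → ℝ) {j k : Fin q} (h : T j k = 0) :
    supportFill T x j k = 0 := by
  rw [supportFill, dif_neg]
  simpa [mem_supp] using h

theorem supportFill_sub (x y : supp T → ℝ) :
    supportFill T (x - y) = supportFill T x - supportFill T y := by
  ext j k
  rw [Matrix.sub_apply]
  unfold supportFill
  split <;> simp

theorem continuous_supportFill_apply (j k : Fin q) :
    Continuous fun x : supp T → ℝ => supportFill T x j k := by
  unfold supportFill
  split
  · exact continuous_apply _
  · exact continuous_const

theorem abs_supportFill_apply_le (x : supp T → ℝ) (j k : Fin q) : |supportFill T x j k| ≤ ‖x‖ := by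
  unfold supportFill
  split
  · exact norm_le_pi_norm x _
  · simp

/-- The maximal degree enters the theorem here: it converts an entrywise bound on a perturbation
supported on 𝒜 into a row-sum bound. -/
theorem row_sum_supportFill_le (x : supp T → ℝ) (j : Fin q) :
    ∑ k, |supportFill T x j k| ≤ maxDegree T * ‖x‖ := by
  calc ∑ k, |supportFill T x j k|
      = ∑ k ∈ Finset.univ.filter fun k => T j k ≠ 0, |supportFill T x j k| := by
        symm
        apply Finset.sum_subset (Finset.subset_univ _)
        intro k _ hk
        rw [supportFill_apply_of_eq_zero x (by simpa using hk), abs_zero]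
    _ ≤ ∑ _k ∈ Finset.univ.filter fun k => T j k ≠ 0, ‖x‖ :=
        Finset.sum_le_sum fun k _ => abs_supportFill_apply_le x j k
    _ ≤ maxDegree T * ‖x‖ := by
        rw [Finset.sum_const, nsmul_eq_mul]
        gcongr
        exact card_le_maxDegree T j

end SupportFill

variable {S : Matrix (Fin q) (Fin q) ℝ}

theorem isSymm_of_posDef (hS : S.PosDef) (j k : Fin q) : S j k = S k j := by
  simpa using hS.isHermitian.apply k j

/-- By symmetry of `S`, the map `X ↦ S X S` is the Kronecker product acting on entries, so the
blocks `hessianAA` and `hessianAcA` compute its values on and off the support. -/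
theorem mul_supportFill_mul_apply (hS : S.PosDef) (x : supp S⁻¹ → ℝ) (j k : Fin q) :
    (S * supportFill S⁻¹ x * S) j k = ∑ p : supp S⁻¹, S j p.1.1 * S k p.1.2 * x p := by
  have h1 : (S * supportFill S⁻¹ x * S) j k =
      ∑ p : Fin q × Fin q, S j p.1 * S k p.2 * supportFill S⁻¹ x p.1 p.2 := by
    rw [Fintype.sum_prod_type_right, Matrix.mul_apply]
    refine Finset.sum_congr rfl fun b _ => ?_
    rw [Matrix.mul_apply, Finset.sum_mul]
    refine Finset.sum_congr rfl fun a _ => ?_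
    rw [isSymm_of_posDef hS b k]
    ring
  rw [h1, ← Finset.sum_subset (Finset.subset_univ (supp S⁻¹)), ← Finset.sum_coe_sort]
  · exact Finset.sum_congr rfl fun p _ => by rw [supportFill_apply_mem]
  · intro p _ hp
    rw [supportFill_apply_of_eq_zero, mul_zero]
    simpa [mem_supp] using hp

theorem hessianAA_mulVec (hS : S.PosDef) (x : supp S⁻¹ → ℝ) (p : supp S⁻¹) :
    (hessianAA S).mulVec x p = (S * supportFill S⁻¹ x * S) p.1.1 p.1.2 := by
  rw [mul_supportFill_mul_apply hS]
  rfl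

theorem hessianAcA_mulVec (hS : S.PosDef) (x : supp S⁻¹ → ℝ)
    (p : ((supp S⁻¹)ᶜ : Finset (Fin q × Fin q))) :
    (hessianAcA S).mulVec x p = (S * supportFill S⁻¹ x * S) p.1.1 p.1.2 := by
  rw [mul_supportFill_mul_apply hS]
  rfl

theorem isUnit_det_hessianAA (hS : S.PosDef) : IsUnit (hessianAA S).det := by
  have h : (hessianAA S).PosDef := (hS.kronecker hS).submatrix Subtype.val_injective
  exact (isUnit_iff_isUnit_det _).1 h.isUnit

/-- The remainder of the first order expansion of matrix inversion at `S⁻¹`. -/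
def invRemainder (S D : Matrix (Fin q) (Fin q) ℝ) : Matrix (Fin q) (Fin q) ℝ :=
  (S⁻¹ + D)⁻¹ - S + S * D * S

section Remainder

variable {D D' : Matrix (Fin q) (Fin q) ℝ} {u δ : ℝ}

theorem K₁_nonneg : 0 ≤ K₁ S := ellInftyNorm_nonneg _

theorem K₂_nonneg : 0 ≤ K₂ S := ellInftyNorm_nonneg _

theorem K₃_nonneg : 0 ≤ K₃ S := ellInftyNorm_nonneg _

theorem posDef_inv_add (hS : S.PosDef) (hD : D.IsHermitian) (hu : u ≤ 1 / 4)
    (h : ∀ i, ∑ j, |(D * S) i j| ≤ u) : (S⁻¹ + D).PosDef := by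
  refine posDef_add_of_row_sum_lt_one hS.inv hD (u := u) (by linarith) ?_
  rwa [nonsing_inv_nonsing_inv _ ((isUnit_iff_isUnit_det _).1 hS.isUnit)]

theorem sub_inv_add_eq (hS : S.PosDef) (hT : (S⁻¹ + D).PosDef) :
    S - (S⁻¹ + D)⁻¹ = (S⁻¹ + D)⁻¹ * (D * S) := by
  have h1 : (S⁻¹ + D)⁻¹ * (S⁻¹ + D) * S = S := by
    rw [nonsing_inv_mul _ ((isUnit_iff_isUnit_det _).1 hT.isUnit), Matrix.one_mul]
  have h2 : S⁻¹ * S = 1 := nonsing_inv_mul _ ((isUnit_iff_isUnit_det _).1 hS.isUnit)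
  rw [Matrix.mul_assoc, Matrix.add_mul, h2, Matrix.mul_add, Matrix.mul_one] at h1
  exact (eq_sub_of_add_eq' h1).symm

/-- The identity `V = S - V (D S)` bounds the norm of `V = (S⁻¹ + D)⁻¹` by `K₁ + u‖V‖`. Absorbing
the last term with `u ≤ 1/4` gives the factor `4/3`, without a Neumann series. -/
theorem row_sum_inv_add_le (hS : S.PosDef) (hT : (S⁻¹ + D).PosDef) (hu0 : 0 ≤ u) (hu : u ≤ 1 / 4)
    (h : ∀ i, ∑ j, |(D * S) i j| ≤ u) (i : Fin q) :
    ∑ j, |(S⁻¹ + D)⁻¹ i j| ≤ 4 / 3 * K₁ S := by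
  set V := (S⁻¹ + D)⁻¹ with hV
  have hVS : V = S - V * (D * S) := by rw [← sub_inv_add_eq hS hT]; simp [hV]
  have hrow : ∀ i, ∑ j, |V i j| ≤ ellInftyNorm V := row_sum_le_ellInftyNorm V
  have hle : ∀ i, ∑ j, |V i j| ≤ K₁ S + ellInftyNorm V * u := by
    intro i
    calc ∑ j, |V i j| = ∑ j, |S i j - (V * (D * S)) i j| := by
          conv_lhs => rw [hVS]
          rfl
      _ ≤ ∑ j, (|S i j| + |(V * (D * S)) i j|) :=
          Finset.sum_le_sum fun j _ => abs_sub _ _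
      _ ≤ _ := by
          rw [Finset.sum_add_distrib]
          exact add_le_add (row_sum_le_ellInftyNorm S i) (row_sum_mul_le hu0 hrow h i)
  have h0 : 0 ≤ ellInftyNorm V := ellInftyNorm_nonneg V
  have hN : ellInftyNorm V ≤ K₁ S + ellInftyNorm V * u :=
    Real.iSup_le hle (by have := K₁_nonneg (S := S); positivity)
  have := hrow i
  nlinarith

/-- Two uses of the resolvent identity write the remainder exactly as `V (D S) (D S)` with `V = (S⁻¹
+ D)⁻¹`. One factor `D S` is measured by row sums and the other entrywise. -/
theorem abs_invRemainder_le (hS : S.PosDef) (hD : D.IsHermitian) (hu0 : 0 ≤ u) (hu : u ≤ 1 / 4)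
    (h : ∀ i, ∑ j, |(D * S) i j| ≤ u) (hδ : 0 ≤ δ) (hDδ : ∀ i j, |D i j| ≤ δ) (i j : Fin q) :
    |invRemainder S D i j| ≤ 4 / 3 * (K₁ S ^ 2 * u) * δ := by
  have hT := posDef_inv_add hS hD hu h
  have hK := K₁_nonneg (S := S)
  have heq : invRemainder S D = ((S⁻¹ + D)⁻¹ * (D * S)) * (D * S) := by
    rw [← sub_inv_add_eq hS hT, Matrix.sub_mul, ← sub_inv_add_eq hS hT, invRemainder,
      Matrix.mul_assoc]
    abel
  rw [heq]
  have h1 : ∀ i j, |(D * S) i j| ≤ δ * K₁ S := fun i j => by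
    refine abs_mul_apply_le_of_col_sum hδ hDδ (fun j => ?_) i j
    simp only [fun i => isSymm_of_posDef hS i j]
    exact row_sum_le_ellInftyNorm S j
  have h2 := abs_mul_apply_le_of_row_sum (by positivity)
    (row_sum_mul_le hu0 (row_sum_inv_add_le hS hT hu0 hu h) h) h1 i j
  calc _ ≤ _ := h2
    _ = _ := by ring

/-- With `V`, `V'` the two inverses and `Δ = D - D'`, the difference equals `(S - V) Δ V' + S Δ (S -
V')`. Each summand carries a factor of size `u`, and `28/9 = 16/9 + 4/3`. -/
theorem abs_invRemainder_sub_le (hS : S.PosDef) (hD : D.IsHermitian) (hD' : D'.IsHermitian)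
    (hu0 : 0 ≤ u) (hu : u ≤ 1 / 4) (h : ∀ i, ∑ j, |(D * S) i j| ≤ u)
    (h' : ∀ i, ∑ j, |(D' * S) i j| ≤ u) (hδ : 0 ≤ δ) (hDδ : ∀ i j, |(D - D') i j| ≤ δ)
    (i j : Fin q) :
    |invRemainder S D i j - invRemainder S D' i j| ≤ 28 / 9 * (K₁ S ^ 2 * u) * δ := by
  have hK := K₁_nonneg (S := S)
  have hT := posDef_inv_add hS hD hu h
  have hT' := posDef_inv_add hS hD' hu h'
  have hV := row_sum_inv_add_le hS hT hu0 hu h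
  have hV' := row_sum_inv_add_le hS hT' hu0 hu h'
  have hdiff : ∀ i, ∑ j, |(S - (S⁻¹ + D)⁻¹) i j| ≤ 4 / 3 * K₁ S * u := by
    rw [sub_inv_add_eq hS hT]
    exact row_sum_mul_le hu0 hV h
  have hdiff' : ∀ i, ∑ j, |(S - (S⁻¹ + D')⁻¹) i j| ≤ 4 / 3 * K₁ S * u := by
    rw [sub_inv_add_eq hS hT']
    exact row_sum_mul_le hu0 hV' h'
  have hres : (S⁻¹ + D)⁻¹ - (S⁻¹ + D')⁻¹ = -((S⁻¹ + D)⁻¹ * (D - D') * (S⁻¹ + D')⁻¹) := by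
    have e1 : (S⁻¹ + D)⁻¹ * (S⁻¹ + D) = 1 :=
      nonsing_inv_mul _ ((isUnit_iff_isUnit_det _).1 hT.isUnit)
    have e2 : (S⁻¹ + D') * (S⁻¹ + D')⁻¹ = 1 :=
      mul_nonsing_inv _ ((isUnit_iff_isUnit_det _).1 hT'.isUnit)
    have e3 : D - D' = (S⁻¹ + D) - (S⁻¹ + D') := by abel
    rw [e3, Matrix.mul_sub, Matrix.sub_mul, e1, Matrix.one_mul, Matrix.mul_assoc, e2,
      Matrix.mul_one, neg_sub]
  have heq : invRemainder S D - invRemainder S D' =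
      (S - (S⁻¹ + D)⁻¹) * (D - D') * (S⁻¹ + D')⁻¹ +
        S * (D - D') * (S - (S⁻¹ + D')⁻¹) := by
    have : invRemainder S D - invRemainder S D' =
        ((S⁻¹ + D)⁻¹ - (S⁻¹ + D')⁻¹) + S * (D - D') * S := by
      simp only [invRemainder, Matrix.mul_sub, Matrix.sub_mul]
      abel
    rw [this, hres]
    simp only [Matrix.mul_sub, Matrix.sub_mul]
    abel
  rw [← Matrix.sub_apply, heq, Matrix.add_apply]
  have hcolV : ∀ j, ∑ i, |(S⁻¹ + D')⁻¹ i j| ≤ 4 / 3 * K₁ S := fun j => by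
    simp only [fun i => isSymm_of_posDef hT'.inv i j]
    exact hV' j
  have hcol : ∀ j, ∑ i, |(S - (S⁻¹ + D')⁻¹) i j| ≤ 4 / 3 * K₁ S * u := fun j => by
    have : ∀ i, (S - (S⁻¹ + D')⁻¹) i j = (S - (S⁻¹ + D')⁻¹) j i := fun i => by
      rw [Matrix.sub_apply, Matrix.sub_apply, isSymm_of_posDef hT'.inv i j,
        isSymm_of_posDef hS i j]
    simp only [this]
    exact hdiff' j
  have b1 := abs_mul_apply_le_of_col_sum (by positivity)
    (abs_mul_apply_le_of_row_sum hδ hdiff hDδ) hcolV i j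
  have b2 := abs_mul_apply_le_of_col_sum (by positivity)
    (abs_mul_apply_le_of_row_sum hδ (row_sum_le_ellInftyNorm S) hDδ) hcol i j
  refine (abs_add_le _ _).trans ((add_le_add b1 b2).trans_eq ?_)
  change 4 / 3 * K₁ S * u * δ * (4 / 3 * K₁ S) + K₁ S * δ * (4 / 3 * K₁ S * u) = _
  ring

end Remainder

/-- The transpose of the filled solution solves the transposed equation, which is the same one
because `Y` is symmetric; invertibility of `hessianAA` makes them equal. Hence the fixed-point map
preserves symmetry, which positive definiteness of `S⁻¹ + D` requires. -/
theorem isHermitian_supportFill_inv_mulVec (hS : S.PosDef) {Y : Matrix (Fin q) (Fin q) ℝ}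
    (hY : Y.IsHermitian) :
    (supportFill S⁻¹ ((hessianAA S)⁻¹.mulVec fun p => Y p.1.1 p.1.2)).IsHermitian := by
  set z := (hessianAA S)⁻¹.mulVec fun p => Y p.1.1 p.1.2 with hz
  have hdet := isUnit_det_hessianAA hS
  have hsymm : ∀ j k, S⁻¹ j k = S⁻¹ k j := isSymm_of_posDef hS.inv
  set z' : supp S⁻¹ → ℝ := fun p => supportFill S⁻¹ z p.1.2 p.1.1 with hz'
  have hfill : supportFill S⁻¹ z' = (supportFill S⁻¹ z)ᵀ := by
    ext j k
    rw [transpose_apply]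
    by_cases h : S⁻¹ j k = 0
    · rw [supportFill_apply_of_eq_zero _ h, supportFill_apply_of_eq_zero _ ((hsymm k j).trans h)]
    · exact supportFill_apply_mem z' ⟨(j, k), mem_supp.2 h⟩
  have hHz : (hessianAA S).mulVec z = fun p => Y p.1.1 p.1.2 := by
    rw [hz, mulVec_mulVec, mul_nonsing_inv _ hdet, one_mulVec]
  have hHz' : (hessianAA S).mulVec z' = (hessianAA S).mulVec z := by
    ext p
    have hSt : Sᵀ = S := by simpa using hS.isHermitian.eq
    have : S * (supportFill S⁻¹ z)ᵀ * S = (S * supportFill S⁻¹ z * S)ᵀ := by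
      rw [transpose_mul, transpose_mul, hSt, Matrix.mul_assoc]
    have hp : p.1.swap ∈ supp S⁻¹ := by
      rw [mem_supp]
      simpa [hsymm p.1.2 p.1.1] using mem_supp.1 p.2
    have hsw := hessianAA_mulVec hS z ⟨p.1.swap, hp⟩
    rw [hHz] at hsw
    rw [hessianAA_mulVec hS, hfill, this, transpose_apply, hHz]
    refine hsw.symm.trans ?_
    simpa using hY.apply p.1.1 p.1.2
  have hzz : z' = z := by
    have := congrArg ((hessianAA S)⁻¹.mulVec) hHz'
    rwa [mulVec_mulVec, mulVec_mulVec, nonsing_inv_mul _ hdet, one_mulVec, one_mulVec] at this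
  rw [hzz] at hfill
  rw [IsHermitian, conjTranspose_eq_transpose_of_trivial, ← hfill]

theorem isHermitian_invRemainder (hS : S.IsHermitian) {D : Matrix (Fin q) (Fin q) ℝ}
    (hD : D.IsHermitian) : (invRemainder S D).IsHermitian := by
  refine ((hS.inv.add hD).inv.sub hS).add ?_
  have := isHermitian_conjTranspose_mul_mul S hD
  rwa [hS.eq] at this

/-- Existence of the oracle estimator near the true precision matrix, with control of the gradient
of the loss off the support. -/
theorem exists_oracle_precision (hS : S.PosDef) {W : Matrix (Fin q) (Fin q) ℝ}
    (hW : W.IsHermitian) {ε : ℝ} (hε : 0 ≤ ε)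
    (h1 : 6 * K₁ S * K₂ S * maxDegree S⁻¹ * ε ≤ 1)
    (h2 : 6 * K₁ S ^ 3 * K₂ S ^ 2 * maxDegree S⁻¹ * ε ≤ 1)
    (hA : ∀ j k, S⁻¹ j k ≠ 0 → |W j k - S j k| ≤ ε) :
    ∃ T : Matrix (Fin q) (Fin q) ℝ, T.PosDef ∧ (∀ j k, S⁻¹ j k = 0 → T j k = 0) ∧
      (∀ j k, S⁻¹ j k ≠ 0 → T⁻¹ j k = W j k) ∧
      (∀ j k, |T j k - S⁻¹ j k| ≤ 3 / 2 * (K₂ S * ε)) ∧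
      (∀ j k, S⁻¹ j k = 0 → |T⁻¹ j k - W j k| ≤ (2 * K₃ S + 1) * ε + |W j k - S j k|) := by
  have hK1 := K₁_nonneg (S := S)
  have hK2 := K₂_nonneg (S := S)
  have hK3 := K₃_nonneg (S := S)
  have hdet := isUnit_det_hessianAA hS
  -- The radius allows for the noise `ε` plus a remainder of `ε / 2`, multiplied by `K₂`. The
  -- constants `6` in `h1` and `h2` are those that make both smallness quantities below at most
  -- `1/4`.
  set ρ : ℝ := 3 / 2 * (K₂ S * ε) with hρ
  have hρ0 : 0 ≤ ρ := by positivity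
  set u : ℝ := maxDegree S⁻¹ * ρ * K₁ S with hu_def
  have hu0 : 0 ≤ u := by positivity
  have hu : u ≤ 1 / 4 := by rw [hu_def, hρ]; linarith
  have hKu : K₁ S ^ 2 * u * K₂ S ≤ 1 / 4 := by rw [hu_def, hρ]; linarith
  -- Stationarity on the support reads `S D S = y` there, that is, `F x = x`.
  let y : (supp S⁻¹ → ℝ) → Matrix (Fin q) (Fin q) ℝ := fun x =>
    invRemainder S (supportFill S⁻¹ x) - (W - S)
  let F : (supp S⁻¹ → ℝ) → (supp S⁻¹ → ℝ) := fun x =>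
    (hessianAA S)⁻¹.mulVec fun p => y x p.1.1 p.1.2
  let s : Set (supp S⁻¹ → ℝ) := {x | (supportFill S⁻¹ x).IsHermitian ∧ ‖x‖ ≤ ρ}
  have hsc : IsComplete s := by
    apply IsClosed.isComplete
    refine IsClosed.inter ?_ (isClosed_le continuous_norm continuous_const)
    exact isClosed_eq
      (continuous_matrix fun i j => by simpa using continuous_supportFill_apply j i)
      (continuous_matrix fun i j => continuous_supportFill_apply i j)
  have hrow : ∀ x ∈ s, ∀ i, ∑ j, |(supportFill S⁻¹ x * S) i j| ≤ u := fun x hx =>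
    row_sum_mul_le hK1 (fun i => (row_sum_supportFill_le x i).trans
      (mul_le_mul_of_nonneg_left hx.2 (Nat.cast_nonneg _))) (row_sum_le_ellInftyNorm S)
  have hR : ∀ x ∈ s, ∀ i j, |invRemainder S (supportFill S⁻¹ x) i j| ≤
      4 / 3 * (K₁ S ^ 2 * u) * ρ := fun x hx =>
    abs_invRemainder_le hS hx.1 hu0 hu (hrow x hx) hρ0
      fun i j => (abs_supportFill_apply_le x i j).trans hx.2
  have hRε : 4 / 3 * (K₁ S ^ 2 * u) * ρ ≤ ε / 2 := by
    calc 4 / 3 * (K₁ S ^ 2 * u) * ρ = 2 * (K₁ S ^ 2 * u * K₂ S) * ε := by rw [hρ]; ring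
      _ ≤ 2 * (1 / 4) * ε := by gcongr
      _ = ε / 2 := by ring
  have hmaps : MapsTo F s s := by
    intro x hx
    constructor
    · exact isHermitian_supportFill_inv_mulVec hS
        ((isHermitian_invRemainder hS.isHermitian hx.1).sub (hW.sub hS.isHermitian))
    · rw [pi_norm_le_iff_of_nonneg hρ0]
      intro p
      have hy : ∀ p : supp S⁻¹, |y x p.1.1 p.1.2| ≤ ε / 2 + ε := fun p =>
        (abs_sub _ _).trans (add_le_add ((hR x hx _ _).trans hRε) (hA _ _ (mem_supp.1 p.2)))
      refine (abs_mulVec_le (by positivity) hy p).trans_eq ?_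
      change K₂ S * (ε / 2 + ε) = ρ
      rw [hρ]; ring
  -- The ratio is `28/9 · 1/4`, from the Lipschitz bound on the remainder and `hKu`.
  have hcontr : ContractingWith (7 / 9) (hmaps.restrict F s s) := by
    refine ⟨by rw [← NNReal.coe_lt_coe]; norm_num, LipschitzWith.of_dist_le_mul ?_⟩
    rintro ⟨x, hx⟩ ⟨x', hx'⟩
    change dist (F x) (F x') ≤ _ * dist x x'
    rw [dist_eq_norm, dist_eq_norm]
    have hsub : F x - F x' = (hessianAA S)⁻¹.mulVec fun p =>
        invRemainder S (supportFill S⁻¹ x) p.1.1 p.1.2 -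
          invRemainder S (supportFill S⁻¹ x') p.1.1 p.1.2 := by
      change Matrix.mulVec _ _ - Matrix.mulVec _ _ = _
      rw [← mulVec_sub]
      congr 1
      ext p
      simp [y]
    rw [hsub, pi_norm_le_iff_of_nonneg (by positivity)]
    intro p
    have hlip := abs_invRemainder_sub_le hS hx.1 hx'.1 hu0 hu (hrow x hx) (hrow x' hx')
      (norm_nonneg (x - x')) (fun i j => by
        rw [← supportFill_sub]; exact abs_supportFill_apply_le _ i j)
    refine (abs_mulVec_le (by positivity) (fun p => hlip _ _) p).trans ?_
    calc K₂ S * (28 / 9 * (K₁ S ^ 2 * u) * ‖x - x'‖)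
        = 28 / 9 * (K₁ S ^ 2 * u * K₂ S) * ‖x - x'‖ := by ring
      _ ≤ 28 / 9 * (1 / 4) * ‖x - x'‖ := by gcongr
      _ = _ := by push_cast; ring
  have h0 : (0 : supp S⁻¹ → ℝ) ∈ s := by
    constructor
    · have : supportFill S⁻¹ (0 : supp S⁻¹ → ℝ) = 0 := by
        ext j k; simp [supportFill]
      rw [this]
      exact isHermitian_zero
    · simpa using hρ0
  obtain ⟨x, hxs, hfix, -⟩ := hcontr.exists_fixedPoint' hsc hmaps h0 (edist_ne_top _ _)
  have hx : F x = x := hfix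
  have hT := posDef_inv_add hS hxs.1 hu (hrow x hxs)
  have hHx : ∀ p : supp S⁻¹, (S * supportFill S⁻¹ x * S) p.1.1 p.1.2 = y x p.1.1 p.1.2 := by
    intro p
    rw [← hessianAA_mulVec hS]
    conv_lhs => rw [← hx]
    change (hessianAA S).mulVec ((hessianAA S)⁻¹.mulVec fun p => y x p.1.1 p.1.2) p = _
    rw [mulVec_mulVec, mul_nonsing_inv _ hdet, one_mulVec]
  have hinv : ∀ j k, (S⁻¹ + supportFill S⁻¹ x)⁻¹ j k - W j k =
      y x j k - (S * supportFill S⁻¹ x * S) j k := by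
    intro j k
    simp only [y, invRemainder, Matrix.sub_apply, Matrix.add_apply]
    ring
  refine ⟨S⁻¹ + supportFill S⁻¹ x, hT, ?_, ?_, ?_, ?_⟩
  · intro j k h
    rw [Matrix.add_apply, h, supportFill_apply_of_eq_zero x h, add_zero]
  · intro j k h
    rw [← sub_eq_zero, hinv, hHx ⟨(j, k), mem_supp.2 h⟩, sub_self]
  · intro j k
    rw [Matrix.add_apply, add_sub_cancel_left]
    exact (abs_supportFill_apply_le x j k).trans hxs.2
  · intro j k h
    have hp : (j, k) ∈ (supp S⁻¹)ᶜ := by simpa [mem_supp] using h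
    -- Substituting the fixed-point equation for `x` expresses `S D S` off the support through `y`
    -- on the support, via the matrix whose norm is `K₃`.
    have hHAc : (S * supportFill S⁻¹ x * S) j k =
        (hessianAcA S * (hessianAA S)⁻¹).mulVec (fun p => y x p.1.1 p.1.2) ⟨(j, k), hp⟩ := by
      rw [← mulVec_mulVec, ← hessianAcA_mulVec hS x ⟨(j, k), hp⟩]
      conv_lhs => rw [← hx]
    have hy : ∀ p : supp S⁻¹, |y x p.1.1 p.1.2| ≤ ε / 2 + ε := fun p =>
      (abs_sub _ _).trans (add_le_add ((hR x hxs _ _).trans hRε) (hA _ _ (mem_supp.1 p.2)))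
    have hb := abs_mulVec_le (X := hessianAcA S * (hessianAA S)⁻¹) (by positivity) hy ⟨(j, k), hp⟩
    rw [← hHAc] at hb
    change _ ≤ K₃ S * _ at hb
    have hyjk : |y x j k| ≤ ε / 2 + |W j k - S j k| :=
      (abs_sub _ _).trans (add_le_add ((hR x hxs _ _).trans hRε) le_rfl)
    rw [hinv]
    refine (abs_sub _ _).trans ((add_le_add hyjk hb).trans ?_)
    have := mul_nonneg hK3 hε
    linarith

end FixedPoint

/-! ### Optimality conditions and the deterministic convergence of the LLA algorithm. -/

section LLA

open Matrix

variable {q : ℕ} {W : Matrix (Fin q) (Fin q) ℝ}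

theorem trace_mul_eq_sum_of_isHermitian {V U : Matrix (Fin q) (Fin q) ℝ} (hU : U.IsHermitian) :
    (V * U).trace = ∑ j, ∑ k, U j k * V j k := by
  rw [Matrix.trace]
  refine Finset.sum_congr rfl fun j _ => ?_
  rw [diag_apply, Matrix.mul_apply]
  refine Finset.sum_congr rfl fun k _ => ?_
  have : U k j = U j k := by simpa using hU.apply j k
  rw [this, mul_comm]

/-- Strict convexity in first-order form, with `W - T⁻¹` as the gradient of the loss at `T`. Both
optimality statements below, and their uniqueness, rest on it. -/
theorem loss_add_lt {T U : Matrix (Fin q) (Fin q) ℝ} (hT : T.PosDef) (hU : U.PosDef)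
    (hne : U ≠ T) :
    loss W T + ∑ j, ∑ k, (U j k - T j k) * (W j k - T⁻¹ j k) < loss W U := by
  have h1 := log_det_sub_log_det_lt hT hU hne
  have h2 : (T⁻¹ * T).trace = q := by
    rw [nonsing_inv_mul _ ((isUnit_iff_isUnit_det _).1 hT.isUnit)]
    simp
  rw [trace_mul_eq_sum_of_isHermitian hU.isHermitian, Fintype.card_fin] at h1
  rw [trace_mul_eq_sum_of_isHermitian hT.isHermitian] at h2
  have h3 : ∑ j, ∑ k, (U j k - T j k) * (W j k - T⁻¹ j k) =
      ∑ j, ∑ k, U j k * W j k - ∑ j, ∑ k, T j k * W j k -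
        ∑ j, ∑ k, U j k * T⁻¹ j k + ∑ j, ∑ k, T j k * T⁻¹ j k := by
    simp only [← Finset.sum_add_distrib, ← Finset.sum_sub_distrib]
    refine Finset.sum_congr rfl fun j _ => Finset.sum_congr rfl fun k _ => ?_
    ring
  rw [h3]
  unfold loss
  linarith

theorem argminOn_eq_singleton {α : Type*} {C : Set α} {f : α → ℝ} {x : α} (hx : x ∈ C)
    (h : ∀ y ∈ C, y ≠ x → f x < f y) : argminOn C f = {x} := by
  ext y
  constructor
  · rintro ⟨hy, hmin⟩
    by_contra hne
    exact (h y hy hne).not_ge (hmin x hx)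
  · rintro rfl
    refine ⟨hx, fun z hz => ?_⟩
    rcases eq_or_ne z y with rfl | hne
    · exact le_rfl
    · exact (h z hz hne).le

theorem isOracle_of_gradient {Q T : Matrix (Fin q) (Fin q) ℝ} (hT : T.PosDef)
    (hT0 : ∀ j k, Q j k = 0 → T j k = 0) (hgrad : ∀ j k, Q j k ≠ 0 → T⁻¹ j k = W j k) :
    IsOracle Q W T := by
  refine argminOn_eq_singleton ⟨hT, hT0⟩ ?_
  rintro U ⟨hU, hU0⟩ hne
  have h := loss_add_lt (W := W) hT hU hne
  have h0 : ∑ j, ∑ k, (U j k - T j k) * (W j k - T⁻¹ j k) = 0 := by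
    refine Finset.sum_eq_zero fun j _ => Finset.sum_eq_zero fun k _ => ?_
    by_cases hq : Q j k = 0
    · rw [hU0 j k hq, hT0 j k hq, sub_zero, zero_mul]
    · rw [hgrad j k hq, sub_self, mul_zero]
  linarith

/-- On the support of `Q` both gradient and weights vanish; off it the weights dominate the
gradient, so the penalty of `U` pays for any first-order decrease. The unpenalized diagonal is
harmless because `hdiag` puts it in the support. Strictness comes from the loss alone, so the
comparisons with `κ` may be equalities. -/
theorem llaStep_eq_singleton {Q T V : Matrix (Fin q) (Fin q) ℝ} {dP : ℝ → ℝ} {κ : ℝ}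
    (hT : T.PosDef) (hdiag : ∀ j, Q j j ≠ 0) (hT0 : ∀ j k, Q j k = 0 → T j k = 0)
    (hgrad : ∀ j k, Q j k ≠ 0 → T⁻¹ j k = W j k)
    (hgrad' : ∀ j k, Q j k = 0 → |T⁻¹ j k - W j k| ≤ κ)
    (hV : ∀ j k, Q j k ≠ 0 → dP |V j k| = 0) (hV' : ∀ j k, Q j k = 0 → κ ≤ dP |V j k|) :
    llaStep dP W V = {T} := by
  refine argminOn_eq_singleton (show T ∈ {U : Matrix (Fin q) (Fin q) ℝ | U.PosDef} from hT) ?_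
  intro U hU hne
  have h := loss_add_lt (W := W) hT hU hne
  have hpenT :
      ∑ jk ∈ (Finset.univ : Finset (Fin q)).offDiag, dP |V jk.1 jk.2| * |T jk.1 jk.2| = 0 := by
    refine Finset.sum_eq_zero fun p _ => ?_
    by_cases hq : Q p.1 p.2 = 0
    · rw [hT0 _ _ hq, abs_zero, mul_zero]
    · rw [hV _ _ hq, zero_mul]
  have hlow : -∑ jk ∈ (Finset.univ : Finset (Fin q)).offDiag, dP |V jk.1 jk.2| * |U jk.1 jk.2| ≤
      ∑ j, ∑ k, (U j k - T j k) * (W j k - T⁻¹ j k) := by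
    rw [← Fintype.sum_prod_type' (f := fun j k => (U j k - T j k) * (W j k - T⁻¹ j k)),
      ← Finset.sum_subset (Finset.subset_univ (Finset.univ : Finset (Fin q)).offDiag),
      ← Finset.sum_neg_distrib]
    · refine Finset.sum_le_sum fun p _ => ?_
      by_cases hq : Q p.1 p.2 = 0
      · rw [hT0 _ _ hq, sub_zero]
        have h1 : |U p.1 p.2 * (W p.1 p.2 - T⁻¹ p.1 p.2)| ≤ dP |V p.1 p.2| * |U p.1 p.2| := by
          rw [abs_mul, mul_comm, abs_sub_comm]
          exact mul_le_mul_of_nonneg_right ((hgrad' _ _ hq).trans (hV' _ _ hq)) (abs_nonneg _)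
        exact (abs_le.1 h1).1
      · rw [hgrad _ _ hq, sub_self, mul_zero, hV _ _ hq, zero_mul, neg_zero]
    · rintro ⟨j, k⟩ - hp
      have hjk : j = k := by
        by_contra hjk
        exact hp (by simpa using hjk)
      subst hjk
      rw [hgrad _ _ (hdiag j), sub_self, mul_zero]
  change loss W T + _ < loss W U + _
  rw [hpenT]
  linarith

theorem llaConvergesAfterTwo_of_llaStep {dP : ℝ → ℝ} {Tinit T : Matrix (Fin q) (Fin q) ℝ}
    (h1 : llaStep dP W Tinit = {T}) (h2 : llaStep dP W T = {T}) :
    LLAConvergesAfterTwo dP W Tinit T := by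
  constructor
  · refine ⟨fun m => if m = 0 then Tinit else T, rfl, fun m => ?_⟩
    rcases Nat.eq_zero_or_pos m with rfl | hm
    · simp [h1]
    · simp [hm.ne', h2]
  · rintro R ⟨hR0, hR⟩ m hm
    induction m, hm using Nat.le_induction with
    | base =>
      have := hR 0
      rwa [hR0, h1, mem_singleton_iff] at this
    | succ m _ ih =>
      have := hR m
      rwa [ih, h2, mem_singleton_iff] at this

theorem abs_apply_le_maxNorm (U : Matrix (Fin q) (Fin q) ℝ) (j k : Fin q) :
    |U j k| ≤ maxNorm U :=
  le_ciSup (f := fun p : Fin q × Fin q => |U p.1 p.2|) (Set.finite_range _).bddAbove (j, k)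

theorem minSignal_le {Q : Matrix (Fin q) (Fin q) ℝ} {j k : Fin q} (h : Q j k ≠ 0) :
    minSignal Q ≤ |Q j k| :=
  ciInf_le (f := fun p : supp Q => |Q p.1.1 p.1.2|) (Set.finite_range _).bddBelow
    ⟨(j, k), mem_supp.2 h⟩

/-- On the event that the sample covariance matrix and the initial estimator are close to their
targets, the LLA algorithm finds the oracle estimator. -/
theorem exists_oracle_and_llaConvergesAfterTwo {S Tinit : Matrix (Fin q) (Fin q) ℝ} (hS : S.PosDef)
    (hW : W.IsHermitian) {P dP : ℝ → ℝ} {lam a a₁ a₂ ε : ℝ} (hlam : 0 < lam)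
    (hP : IsFoldedConcavePenalty P dP lam a a₁ a₂) (hmin : (a + 1) * lam < minSignal S⁻¹)
    (hinit : maxNorm (Tinit - S⁻¹) ≤ min 1 a₂ * lam) (hε : 0 ≤ ε)
    (h1 : 6 * K₁ S * K₂ S * maxDegree S⁻¹ * ε ≤ 1)
    (h2 : 6 * K₁ S ^ 3 * K₂ S ^ 2 * maxDegree S⁻¹ * ε ≤ 1)
    (h3 : 2 * K₂ S * ε ≤ minSignal S⁻¹ - a * lam)
    (h4 : 2 * (2 * K₃ S + 1) * ε ≤ a₁ * lam)
    (hA : ∀ j k, S⁻¹ j k ≠ 0 → |W j k - S j k| ≤ ε)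
    (hAc : ∀ j k, S⁻¹ j k = 0 → |W j k - S j k| ≤ a₁ * lam / 2) :
    ∃ T, IsOracle S⁻¹ W T ∧ LLAConvergesAfterTwo dP W Tinit T := by
  obtain ⟨T, hT, hT0, hgrad, hclose, hgrad'⟩ := exists_oracle_precision hS hW hε h1 h2 hA
  have hdiag : ∀ j, S⁻¹ j j ≠ 0 := fun j => hS.inv.diag_pos.ne'
  have hκ : ∀ j k, S⁻¹ j k = 0 → |T⁻¹ j k - W j k| ≤ a₁ * lam := fun j k h => by
    have := hgrad' j k h
    have := hAc j k h
    linarith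
  -- The properties of `V` required here hold for `Tinit`, which is within `lam` and within `a₂ *
  -- lam` of `S⁻¹`, and for `T`, which vanishes off the support and satisfies `h3`.
  have hstep : ∀ V : Matrix (Fin q) (Fin q) ℝ, (∀ j k, S⁻¹ j k ≠ 0 → a * lam ≤ |V j k|) →
      (∀ j k, S⁻¹ j k = 0 → |V j k| ≤ a₂ * lam) → llaStep dP W V = {T} := by
    intro V hV hV'
    refine llaStep_eq_singleton hT hdiag hT0 hgrad hκ
      (fun j k h => hP.deriv_eq_zero _ (hV j k h)) fun j k h => ?_
    rcases (abs_nonneg (V j k)).eq_or_lt with h0 | h0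
    · rw [← h0]; exact hP.le_deriv_zero
    · exact hP.le_deriv _ h0 (hV' j k h)
  refine ⟨T, isOracle_of_gradient hT hT0 hgrad,
    llaConvergesAfterTwo_of_llaStep (hstep _ ?_ ?_) (hstep _ ?_ ?_)⟩
  · intro j k h
    have e1 := (abs_apply_le_maxNorm (Tinit - S⁻¹) j k).trans hinit
    have e2 : min 1 a₂ * lam ≤ 1 * lam := by gcongr; exact min_le_left _ _
    have e3 := minSignal_le h
    have e4 := abs_sub_abs_le_abs_sub (S⁻¹ j k) (Tinit j k)
    rw [abs_sub_comm] at e4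
    rw [Matrix.sub_apply] at e1
    linarith
  · intro j k h
    have e1 := (abs_apply_le_maxNorm (Tinit - S⁻¹) j k).trans hinit
    have e2 : min 1 a₂ * lam ≤ a₂ * lam := by gcongr; exact min_le_right _ _
    rw [Matrix.sub_apply, h, sub_zero] at e1
    exact e1.trans e2
  · intro j k h
    have e1 := hclose j k
    have e3 := minSignal_le h
    have e4 := abs_sub_abs_le_abs_sub (S⁻¹ j k) (T j k)
    rw [abs_sub_comm] at e4
    linarith
  · intro j k h
    rw [hT0 j k h, abs_zero]
    have := hP.a₂_pos
    positivity

end LLA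

/-! ### The good event and its probability. -/

section Probability

open Matrix

variable {q : ℕ} {S : Matrix (Fin q) (Fin q) ℝ}

/-- A diagonal entry of `H_𝒜𝒜⁻¹ H_𝒜𝒜 = 1` is estimated using that the entries of `H` are at most `K₁
M`. This makes `K₁` and `K₂` positive and later keeps `ε` below `M`, inside the range of the
concentration bound. -/
theorem one_le_K₁_mul_K₂_mul (hS : S.PosDef) {M : ℝ} (hM : ∀ i, S i i ≤ M) (i : Fin q) :
    1 ≤ K₁ S * K₂ S * M := by
  have hp : (i, i) ∈ supp S⁻¹ := mem_supp.2 hS.inv.diag_pos.ne'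
  have hM0 : 0 ≤ M := hS.diag_pos.le.trans (hM i)
  have hK1 := K₁_nonneg (S := S)
  have hentry : ∀ j k, |S j k| ≤ K₁ S := fun j k =>
    (Finset.single_le_sum (f := fun k => |S j k|) (fun _ _ => abs_nonneg _)
      (Finset.mem_univ k)).trans (row_sum_le_ellInftyNorm S j)
  have hH : ∀ a b, |hessianAA S a b| ≤ K₁ S * M := fun a b => by
    change |S _ _ * S _ _| ≤ _
    rw [abs_mul]
    exact mul_le_mul (hentry _ _) (abs_apply_le_of_posSemidef hS.posSemidef hM _ _)
      (abs_nonneg _) hK1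
  have h := abs_mul_apply_le_of_row_sum (by positivity)
    (row_sum_le_ellInftyNorm (hessianAA S)⁻¹) hH ⟨(i, i), hp⟩ ⟨(i, i), hp⟩
  rw [nonsing_inv_mul _ (isUnit_det_hessianAA hS), one_apply_eq, abs_one] at h
  change 1 ≤ K₂ S * _ at h
  linarith

theorem one_le_maxDegree (hS : S.PosDef) (i : Fin q) : 1 ≤ maxDegree S⁻¹ := by
  refine le_trans ?_ (card_le_maxDegree S⁻¹ i)
  rw [Nat.one_le_iff_ne_zero, ← Nat.pos_iff_ne_zero, Finset.card_pos]
  exact ⟨i, by simpa using hS.inv.diag_pos.ne'⟩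

theorem posSemidef_sampleCov {n : ℕ} (x : Fin n → EuclideanSpace ℝ (Fin q)) :
    (sampleCov x).PosSemidef := by
  have : sampleCov x = (n : ℝ)⁻¹ • ((Matrix.of fun k i => x k i - sampleMean x i)ᴴ *
      Matrix.of fun k i => x k i - sampleMean x i) := by
    ext i j
    simp [sampleCov, Matrix.mul_apply, div_eq_inv_mul]
  rw [this]
  exact (posSemidef_conjTranspose_mul_self _).smul (by positivity)

theorem card_filter_le (q : ℕ) :
    ((((Finset.univ : Finset (Fin q × Fin q)).filter fun p => p.1 ≤ p.2).card : ℕ) : ℝ) =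
      (q : ℝ) * (q + 1) / 2 := by
  have h1 : ((Finset.univ : Finset (Fin q × Fin q)).filter fun p => p.1 ≤ p.2).card =
      ∑ j : Fin q, (j.1 + 1) := by
    rw [Finset.card_filter, Fintype.sum_prod_type_right]
    refine Finset.sum_congr rfl fun k _ => ?_
    rw [← Finset.card_filter, ← Fin.card_Iic]
    congr 1
    ext j
    simp
  rw [h1, Fin.sum_univ_eq_sum_range (fun j => j + 1)]
  push_cast
  clear h1
  induction q with
  | zero => simp
  | succ q ih => rw [Finset.sum_range_succ, ih]; push_cast; ring

theorem card_compl_supp (T : Matrix (Fin q) (Fin q) ℝ) :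
    ((((supp T)ᶜ.filter fun p => p.1 ≤ p.2).card : ℕ) : ℝ) =
      (q : ℝ) * (q + 1) / 2 - suppCard T := by
  rw [← card_filter_le, suppCard, eq_sub_iff_add_eq, ← Nat.cast_add]
  congr 1
  rw [← Finset.card_union_of_disjoint]
  · rw [← Finset.filter_union, Finset.union_comm, Finset.union_compl]
  · exact Finset.disjoint_filter_filter disjoint_compl_left

/-- The complement of a measurable hull works, so the bad event may be treated by outer measure. -/
theorem exists_measurableSet_subset_compl {Ω : Type*} [MeasurableSpace Ω] (Pr : Measure Ω)
    [IsProbabilityMeasure Pr] (B : Set Ω) :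
    ∃ E, MeasurableSet E ∧ E ⊆ Bᶜ ∧ Pr.real E = 1 - Pr.real B := by
  refine ⟨(toMeasurable Pr B)ᶜ, (measurableSet_toMeasurable _ _).compl,
    compl_subset_compl.2 (subset_toMeasurable _ _), ?_⟩
  rw [probReal_compl_eq_one_sub (measurableSet_toMeasurable _ _), Measure.real, Measure.real,
    measure_toMeasurable]

theorem measureReal_biUnion_le_card_mul {Ω ι : Type*} [MeasurableSpace Ω] {Pr : Measure Ω}
    [IsProbabilityMeasure Pr] (s : Finset ι) (f : ι → Set Ω) {b : ℝ}
    (h : ∀ i ∈ s, Pr.real (f i) ≤ b) : Pr.real (⋃ i ∈ s, f i) ≤ s.card * b := by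
  refine (measureReal_biUnion_finset_le s f).trans ((Finset.sum_le_sum h).trans_eq ?_)
  simp

theorem measureReal_lla {n : ℕ} {M : ℝ} (hM : 0 < M) {μ : EuclideanSpace ℝ (Fin q)} {Ω : Type*}
    [MeasurableSpace Ω] {Pr : Measure Ω} [IsProbabilityMeasure Pr]
    {x : Fin n → Ω → EuclideanSpace ℝ (Fin q)} {Tinit : Ω → Matrix (Fin q) (Fin q) ℝ}
    {P dP : ℝ → ℝ} {lam a a₁ a₂ : ℝ} (hn : 0 < n) (hS : S.PosDef) (hSM : ∀ i, S i i ≤ M)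
    (hx : IsGaussianSample Pr μ S x) (hlam : 0 < lam)
    (hP : IsFoldedConcavePenalty P dP lam a a₁ a₂) (hmin : (a + 1) * lam < minSignal S⁻¹) :
    ∃ E : Set Ω, MeasurableSet E ∧
      (∀ ω ∈ E, ∃ Torc : Matrix (Fin q) (Fin q) ℝ,
        IsOracle S⁻¹ (sampleCov fun k => x k ω) Torc ∧
        LLAConvergesAfterTwo dP (sampleCov fun k => x k ω) (Tinit ω) Torc) ∧
      1 - Pr.real {ω | min 1 a₂ * lam < maxNorm (Tinit ω - S⁻¹)}
          - delta₁ 8 (1 / (256 * M ^ 2)) n S lam a₁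
          - delta₂ 8 (1 / (256 * M ^ 2)) n S lam a ≤ Pr.real E := by
  have ha1 := hP.a₁_pos
  have ha : 0 < a := hP.a₂_pos.trans hP.a₂_lt_a
  -- For `q = 0` the minimal signal is an infimum over the empty type, hence `0`, which contradicts
  -- `hmin`.
  have hq : Nonempty (Fin q) := by
    by_contra hq
    rw [not_nonempty_iff] at hq
    have : IsEmpty (supp S⁻¹) := ⟨fun p => hq.elim p.1.1⟩
    have h0 : minSignal S⁻¹ = 0 := Real.iInf_of_isEmpty _
    have : 0 < (a + 1) * lam := by positivity
    linarith
  obtain ⟨i₀⟩ := hq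
  have hKK := one_le_K₁_mul_K₂_mul hS hSM i₀
  have hK1 : 0 < K₁ S := K₁_nonneg.lt_of_ne fun h => by rw [← h] at hKK; linarith
  have hK2 : 0 < K₂ S := K₂_nonneg.lt_of_ne fun h => by rw [← h] at hKK; linarith
  have hK3 := K₃_nonneg (S := S)
  have hd1 : (1 : ℝ) ≤ maxDegree S⁻¹ := by exact_mod_cast one_le_maxDegree hS i₀
  have hd : (0 : ℝ) < maxDegree S⁻¹ := by linarith
  have hgap : 0 < minSignal S⁻¹ - a * lam := by linarith
  set c₀ : ℝ := 1 / (256 * M ^ 2) with hc₀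
  have hc₀pos : 0 < c₀ := by positivity
  -- `t₁` controls the gradient off the support, `t₂` and `t₃` make the fixed-point argument work,
  -- and `t₄` keeps the oracle's entries on the support above `a * lam`.
  set t₁ : ℝ := a₁ * lam / (2 * (2 * K₃ S + 1)) with ht₁
  set t₂ : ℝ := 1 / (6 * K₁ S * K₂ S * maxDegree S⁻¹) with ht₂
  set t₃ : ℝ := 1 / (6 * K₁ S ^ 3 * K₂ S ^ 2 * maxDegree S⁻¹) with ht₃
  set t₄ : ℝ := (minSignal S⁻¹ - a * lam) / (2 * K₂ S) with ht₄
  set ε : ℝ := min t₁ (min t₂ (min t₃ t₄)) with hε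
  have hε₁ : ε ≤ t₁ := min_le_left _ _
  have hε₂ : ε ≤ t₂ := (min_le_right _ _).trans (min_le_left _ _)
  have hε₃ : ε ≤ t₃ := (min_le_right _ _).trans ((min_le_right _ _).trans (min_le_left _ _))
  have hε₄ : ε ≤ t₄ := (min_le_right _ _).trans ((min_le_right _ _).trans (min_le_right _ _))
  have hεpos : 0 < ε := by
    refine lt_min ?_ (lt_min ?_ (lt_min ?_ ?_)) <;> positivity
  have hεM : ε ≤ M := by
    refine hε₂.trans ?_
    rw [ht₂, div_le_iff₀ (by positivity)]
    have : 1 * 1 ≤ (K₁ S * K₂ S * M) * maxDegree S⁻¹ :=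
      mul_le_mul hKK hd1 zero_le_one (by linarith)
    linarith
  have h1 : 6 * K₁ S * K₂ S * maxDegree S⁻¹ * ε ≤ 1 := by
    rw [ht₂, le_div_iff₀ (by positivity)] at hε₂; linarith
  have h2 : 6 * K₁ S ^ 3 * K₂ S ^ 2 * maxDegree S⁻¹ * ε ≤ 1 := by
    rw [ht₃, le_div_iff₀ (by positivity)] at hε₃; linarith
  have h3 : 2 * K₂ S * ε ≤ minSignal S⁻¹ - a * lam := by
    rw [ht₄, le_div_iff₀ (by positivity)] at hε₄; linarith
  have h4 : 2 * (2 * K₃ S + 1) * ε ≤ a₁ * lam := by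
    rw [ht₁, le_div_iff₀ (by positivity)] at hε₁; linarith
  set W : Ω → Matrix (Fin q) (Fin q) ℝ := fun ω => sampleCov fun k => x k ω with hW
  have hWpsd : ∀ ω, (W ω).PosSemidef := fun ω => posSemidef_sampleCov _
  have hdev : ∀ ω j k, |W ω j k - S j k| = |W ω k j - S k j| := fun ω j k => by
    have : W ω j k = W ω k j := by simpa using (hWpsd ω).isHermitian.apply k j
    rw [this, isSymm_of_posDef hS j k]
  have hsym : ∀ j k, S⁻¹ j k = S⁻¹ k j := isSymm_of_posDef hS.inv
  have hprob : ∀ j k ν, 0 ≤ ν → ν ≤ 3 * M →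
      Pr.real {ω | ν ≤ |W ω j k - S j k|} ≤ 8 * Real.exp (-c₀ * n * ν ^ 2) := fun j k ν h h' =>
    measureReal_sampleCov_le hM hn hS.posSemidef hSM hx j k h h'
  set B₁ : Set Ω := ⋃ p ∈ (supp S⁻¹).filter fun p => p.1 ≤ p.2,
    {ω | ε ≤ |W ω p.1 p.2 - S p.1 p.2|} with hB₁
  have hB₁le : Pr.real B₁ ≤ suppCard S⁻¹ * (8 * Real.exp (-c₀ * n * ε ^ 2)) :=
    measureReal_biUnion_le_card_mul _ _ fun p _ => hprob _ _ _ hεpos.le (by linarith)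
  have hgood₁ : ∀ ω ∉ B₁, ∀ j k, S⁻¹ j k ≠ 0 → |W ω j k - S j k| ≤ ε := by
    intro ω hω
    have key : ∀ j k, j ≤ k → S⁻¹ j k ≠ 0 → |W ω j k - S j k| ≤ ε := by
      intro j k hjk h
      by_contra! hcon
      exact hω (mem_iUnion₂.2 ⟨(j, k), Finset.mem_filter.2 ⟨mem_supp.2 h, hjk⟩, hcon.le⟩)
    intro j k h
    rcases le_total j k with hjk | hjk
    · exact key j k hjk h
    · rw [hdev]
      exact key k j hjk (by rwa [← hsym])
  -- When `a₁ * lam / 2 > 3M` the tail bound is out of range, but no bad event is needed. Off `B₁`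
  -- the diagonal of `W`, which lies in the support, is at most `M + ε ≤ 2M`; positive
  -- semidefiniteness bounds every entry of `W` by `2M`, so deviations are at most `3M`.
  obtain ⟨B₂, hB₂le, hgood₂⟩ : ∃ B₂ : Set Ω,
      Pr.real B₂ ≤ ((q : ℝ) * (q + 1) / 2 - suppCard S⁻¹) *
        (8 * Real.exp (-c₀ * n * (a₁ * lam / 2) ^ 2)) ∧
      ∀ ω ∉ B₁, ω ∉ B₂ → ∀ j k, S⁻¹ j k = 0 → |W ω j k - S j k| ≤ a₁ * lam / 2 := by
    rcases le_or_gt (a₁ * lam / 2) (3 * M) with hle | hgt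
    · refine ⟨⋃ p ∈ (supp S⁻¹)ᶜ.filter fun p => p.1 ≤ p.2,
        {ω | a₁ * lam / 2 ≤ |W ω p.1 p.2 - S p.1 p.2|}, ?_, ?_⟩
      · rw [← card_compl_supp]
        exact measureReal_biUnion_le_card_mul _ _ fun p _ => hprob _ _ _ (by positivity) hle
      · intro ω _ hω
        have key : ∀ j k, j ≤ k → S⁻¹ j k = 0 → |W ω j k - S j k| ≤ a₁ * lam / 2 := by
          intro j k hjk h
          by_contra! hcon
          refine hω (mem_iUnion₂.2 ⟨(j, k), Finset.mem_filter.2 ⟨?_, hjk⟩, hcon.le⟩)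
          simpa [mem_supp] using h
        intro j k h
        rcases le_total j k with hjk | hjk
        · exact key j k hjk h
        · rw [hdev]
          exact key k j hjk (by rwa [← hsym])
    · refine ⟨∅, ?_, ?_⟩
      · rw [← card_compl_supp, measureReal_empty]
        positivity
      · intro ω hω _ j k _
        have hWd : ∀ i, W ω i i ≤ M + ε := fun i => by
          have := (abs_le.1 (hgood₁ ω hω i i hS.inv.diag_pos.ne')).2
          have := hSM i
          linarith
        have e1 := abs_apply_le_of_posSemidef (hWpsd ω) hWd j k
        have e2 := abs_apply_le_of_posSemidef hS.posSemidef hSM j k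
        have e3 := abs_sub (W ω j k) (S j k)
        linarith
  obtain ⟨E, hEm, hEsub, hEP⟩ := exists_measurableSet_subset_compl Pr
    ({ω | min 1 a₂ * lam < maxNorm (Tinit ω - S⁻¹)} ∪ B₁ ∪ B₂)
  refine ⟨E, hEm, ?_, ?_⟩
  · intro ω hω
    have hω' := hEsub hω
    simp only [mem_compl_iff, mem_union, not_or, mem_ofPred_eq, not_lt] at hω'
    obtain ⟨⟨hinit, hω₁⟩, hω₂⟩ := hω'
    exact exists_oracle_and_llaConvergesAfterTwo hS (hWpsd ω).isHermitian hlam hP hmin hinit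
      hεpos.le h1 h2 h3 h4 (hgood₁ ω hω₁) (hgood₂ ω hω₁ hω₂)
  -- Whichever threshold attains the minimum `ε`, its square appears, up to scaling, in one of the
  -- two exponents. The tail on the support is thus bounded by one exponential, hence by their sum:
  -- `t₁`, `t₂`, `t₃` are charged to `delta₁` and `t₄` to `delta₂`.
  · have hexp : Real.exp (-c₀ * n * ε ^ 2) ≤
        Real.exp (-(c₀ / 4) * n *
          min (a₁ ^ 2 * lam ^ 2 / (2 * K₃ S + 1) ^ 2)
            (min (1 / (9 * K₁ S ^ 2 * K₂ S ^ 2 * (maxDegree S⁻¹ : ℝ) ^ 2))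
              (1 / (9 * K₁ S ^ 6 * K₂ S ^ 4 * (maxDegree S⁻¹ : ℝ) ^ 2)))) +
        Real.exp (-(c₀ * n / (4 * K₂ S ^ 2)) *
          min (1 / (9 * K₁ S ^ 2 * (maxDegree S⁻¹ : ℝ) ^ 2))
            (min (1 / (9 * K₁ S ^ 6 * K₂ S ^ 2 * (maxDegree S⁻¹ : ℝ) ^ 2))
              ((minSignal S⁻¹ - a * lam) ^ 2))) := by
      have left : ∀ m : ℝ, m ≤ 4 * ε ^ 2 → ∀ r : ℝ, Real.exp (-c₀ * n * ε ^ 2) ≤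
          Real.exp (-(c₀ / 4) * n * m) + Real.exp r := by
        intro m hm r
        refine le_add_of_le_of_nonneg (Real.exp_le_exp.2 ?_) (Real.exp_pos _).le
        have : c₀ / 4 * n * m ≤ c₀ / 4 * n * (4 * ε ^ 2) := by gcongr
        linarith
      have right : ∀ m : ℝ, m ≤ (2 * K₂ S * ε) ^ 2 → ∀ r : ℝ, Real.exp (-c₀ * n * ε ^ 2) ≤
          Real.exp r + Real.exp (-(c₀ * n / (4 * K₂ S ^ 2)) * m) := by
        intro m hm r
        refine le_add_of_nonneg_of_le (Real.exp_pos _).le (Real.exp_le_exp.2 ?_)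
        have : c₀ * n / (4 * K₂ S ^ 2) * m ≤ c₀ * n / (4 * K₂ S ^ 2) * (2 * K₂ S * ε) ^ 2 := by
          gcongr
        have e : c₀ * n / (4 * K₂ S ^ 2) * (2 * K₂ S * ε) ^ 2 = c₀ * n * ε ^ 2 := by
          field_simp; ring
        linarith
      have hcases : ε = t₁ ∨ ε = t₂ ∨ ε = t₃ ∨ ε = t₄ := by
        rcases min_choice t₁ (min t₂ (min t₃ t₄)) with h | h
        · exact Or.inl h
        rcases min_choice t₂ (min t₃ t₄) with h' | h'
        · exact Or.inr (Or.inl (h.trans h'))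
        rcases min_choice t₃ t₄ with h'' | h''
        · exact Or.inr (Or.inr (Or.inl (h.trans (h'.trans h''))))
        · exact Or.inr (Or.inr (Or.inr (h.trans (h'.trans h''))))
      rcases hcases with h | h | h | h
      · refine left _ ((min_le_left _ _).trans_eq ?_) _
        rw [h, ht₁]; field_simp; ring
      · refine left _ ((min_le_right _ _).trans ((min_le_left _ _).trans_eq ?_)) _
        rw [h, ht₂]; field_simp; ring
      · refine left _ ((min_le_right _ _).trans ((min_le_right _ _).trans_eq ?_)) _
        rw [h, ht₃]; field_simp; ring
      · refine right _ ((min_le_right _ _).trans ((min_le_right _ _).trans_eq ?_)) _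
        rw [h, ht₄]; field_simp
    have hU : Pr.real ({ω | min 1 a₂ * lam < maxNorm (Tinit ω - S⁻¹)} ∪ B₁ ∪ B₂) ≤
        Pr.real {ω | min 1 a₂ * lam < maxNorm (Tinit ω - S⁻¹)} + Pr.real B₁ + Pr.real B₂ :=
      (measureReal_union_le _ _).trans (add_le_add (measureReal_union_le _ _) le_rfl)
    have hs : (suppCard S⁻¹ : ℝ) * (8 * Real.exp (-c₀ * n * ε ^ 2)) ≤ _ :=
      mul_le_mul_of_nonneg_left (mul_le_mul_of_nonneg_left hexp (by norm_num)) (Nat.cast_nonneg _)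
    have hc2 : -c₀ * n * (a₁ * lam / 2) ^ 2 = -(c₀ * a₁ ^ 2 / 4) * n * lam ^ 2 := by ring
    rw [hc2] at hB₂le
    rw [hEP, delta₁, delta₂]
    linarith

end Probability

end

end SparsePrecision

theorem theorem6 (M : ℝ) (hM : 0 < M) :
    ∃ ν₀ c₀ C₀ : ℝ, 0 < ν₀ ∧ 0 < c₀ ∧ 0 < C₀ ∧
      -- the large deviation bound that defines the constants
      (∀ (q n : ℕ) (S : Matrix (Fin q) (Fin q) ℝ) (μ : EuclideanSpace ℝ (Fin q))
        (Ω : Type*) [MeasurableSpace Ω] (Pr : Measure Ω) [IsProbabilityMeasure Pr]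
        (x : Fin n → Ω → EuclideanSpace ℝ (Fin q)),
        0 < n → S.PosDef → (∀ i, S i i ≤ M) →
        SparsePrecision.IsGaussianSample Pr μ S x →
        ∀ (i j : Fin q) (ν : ℝ), 0 ≤ ν → ν ≤ ν₀ →
          Pr.real {ω | ν ≤ |SparsePrecision.sampleCov (fun k => x k ω) i j - S i j|} ≤
            C₀ * Real.exp (-c₀ * n * ν ^ 2)) ∧
      -- two-step convergence of the LLA algorithm to the oracle estimator
      (∀ (q n : ℕ) (S : Matrix (Fin q) (Fin q) ℝ) (μ : EuclideanSpace ℝ (Fin q))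
        (Ω : Type*) [MeasurableSpace Ω] (Pr : Measure Ω) [IsProbabilityMeasure Pr]
        (x : Fin n → Ω → EuclideanSpace ℝ (Fin q))
        (Tinit : Ω → Matrix (Fin q) (Fin q) ℝ)
        (P dP : ℝ → ℝ) (lam a a₁ a₂ : ℝ),
        0 < n → S.PosDef → (∀ i, S i i ≤ M) →
        SparsePrecision.IsGaussianSample Pr μ S x →
        (∀ i j, Measurable fun ω => Tinit ω i j) →
        0 < lam →
        SparsePrecision.IsFoldedConcavePenalty P dP lam a a₁ a₂ →
        (a + 1) * lam < SparsePrecision.minSignal S⁻¹ →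
        ∃ E : Set Ω, MeasurableSet E ∧
          (∀ ω ∈ E, ∃ Torc : Matrix (Fin q) (Fin q) ℝ,
            SparsePrecision.IsOracle S⁻¹ (SparsePrecision.sampleCov fun k => x k ω) Torc ∧
            SparsePrecision.LLAConvergesAfterTwo dP
              (SparsePrecision.sampleCov fun k => x k ω) (Tinit ω) Torc) ∧
          1 - Pr.real {ω | min 1 a₂ * lam < SparsePrecision.maxNorm (Tinit ω - S⁻¹)}
              - SparsePrecision.delta₁ C₀ c₀ n S lam a₁
              - SparsePrecision.delta₂ C₀ c₀ n S lam a ≤ Pr.real E) := by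
  -- The factor `8` counts four events with two tails each, and `256 M² = 16 (4M)²`. The range `3M`
  -- is what the case of large `lam` in `measureReal_lla` needs.
  refine ⟨3 * M, 1 / (256 * M ^ 2), 8, by positivity, by positivity, by norm_num, ?_, ?_⟩
  · intro q n S μ Ω _ Pr _ x hn hS hSM hx i j ν hν hν'
    exact SparsePrecision.measureReal_sampleCov_le hM hn hS.posSemidef hSM hx i j hν hν'
  · intro q n S μ Ω _ Pr _ x Tinit P dP lam a a₁ a₂ hn hS hSM hx _ hlam hP hmin
    exact SparsePrecision.measureReal_lla hM hn hS hSM hx hlam hP hmin
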